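/- **Variance-bounding Matching Lemma.** There exists an $\frac{8}{15}$-approximation variance-bounding matching algorithm, in the following sense. *Setting.* An input consists of (1) a finite simple graph $H=(V,E)$ with numbers $p_e\in[0,1]$ for $e\in E$, where $\mathcal H$ denotes the random subgraph of $H$ containing each edge $e$ independently with probability $p_e$, and (2) an arbitrary, potentially randomized, algorithm that, given $\mathcal H$, returns a matching $M_{\mathcal O}$ of $\mathcal H$. A randomized algorithm receives the input and the realization $\mathcal H$, and outputs a random pair $(M_c,A)$ with $M_c\subseteq E$ and $A\subseteq V$; it need not be given a sample of $M_{\mathcal O}$, and it is given no edge weights. All probabilities, expectations and variances are over the realization $\mathcal H$ and the randomness of the algorithms. For $\alpha>0$, such an algorithm is an *$\alpha$-approximation variance-bounding matching algorithm* if there is a constant $\delta\in(0,1)$, independent of the input, such that on every input $M_c$ is always a matching of $\mathcal H$, $A$ is always a set of vertices unmatched in $M_c$, and: 1. for all nonnegative edge weights $w$, $\mathbb E\big[\sum_{e\in M_c}w_e\big]\ge \alpha\,\mathbb E\big[\sum_{e\in M_{\mathcal O}}w_e\big]$; 2. for every $v\in V$, $\Pr[v\in A]\ge \Pr[v\text{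 is not matched in }M_{\mathcal O}]$; 3. for any two distinct vertices $u,v$ that are not adjacent in $H$, $\Pr[\{u,v\}\subseteq A]\ge\delta$; 4. for every $\tau\in(0,1)$, every fractional matching $x$ on the complement $\overline H=(V,\overline E)$ of $H$ (that is, $x_e\in[0,1]$ for $e\in\overline E$ and $\sum_{e\in\overline E,\,e\ni v}x_e\le1$ for every $v\in V$) with $x_e\le\tau$ for all $e\in\overline E$, and every $v\in V$, the random variable $$Z_v=\sum_{e=\{u,v\}\in\overline E}\frac{x_e}{\Pr[\{u,v\}\subseteq A]}\,\mathbf 1_{u\in A}$$ satisfies $\operatorname{Var}(Z_v)\le \dfrac{6\tau}{\delta^2}$. The lemma asserts that such an algorithm exists for $\alpha=\frac{8}{15}$. -/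

import Mathlib

universe u

namespace StochMatch

open MeasureTheory ProbabilityTheory

/-! ### Discrete distributions -/

/-- The discrete probability measure (every set is measurable) with mass function `μ`. -/
noncomputable def law {α : Type*} (μ : PMF α) : @Measure α ⊤ :=
  letI : MeasurableSpace α := ⊤
  μ.toMeasure

/-- `Pr[P]` under `μ`. -/
noncomputable def prob {α : Type*} (μ : PMF α) (P : α → Prop) : ℝ :=
  (law μ).real {a | P a}

/-- The expectation of `X` under `μ`. -/
noncomputable def expect {α : Type*} (μ : PMF α) (X : α → ℝ) : ℝ :=
  ∫ a, X a ∂(law μ)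

/-- The variance of `X` under `μ`. -/
noncomputable def var {α : Type*} (μ : PMF α) (X : α → ℝ) : ℝ :=
  variance X (law μ)

/-! ### Matchings and fractional matchings -/

/-- `M` is a matching of the simple graph with edge set `R`: a set of edges of `R`, no two of
which share an endpoint. -/
def IsMatchingOf {V : Type u} (R M : Finset (Sym2 V)) : Prop :=
  M ⊆ R ∧ ∀ e ∈ M, ∀ e' ∈ M, ∀ v : V, v ∈ e → v ∈ e' → e = e'

/-- The vertex `v` is matched by (is an endpoint of an edge of) `M`. -/
def Covers {V : Type u} (M : Finset (Sym2 V)) (v : V) : Prop :=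
  ∃ e ∈ M, v ∈ e

/-- The finite set of neighbours of `v` in `G`. -/
noncomputable def nbrs {V : Type u} [Fintype V] (G : SimpleGraph V) (v : V) : Finset V :=
  (Set.toFinite (G.neighborSet v)).toFinset

/-- `x` (restricted to the edges of `G`) is a fractional matching of `G`; its values off the
edges of `G` are irrelevant. -/
def IsFractionalMatching {V : Type u} [Fintype V] (G : SimpleGraph V) (x : Sym2 V → ℝ) : Prop :=
  (∀ e ∈ G.edgeSet, 0 ≤ x e ∧ x e ≤ 1) ∧ ∀ v : V, ∑ u ∈ nbrs G v, x s(u, v) ≤ 1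

/-! ### Inputs: a stochastic graph and a randomized matching of its realization -/

/-- The finite edge set of a simple graph. -/
noncomputable def edges {V : Type u} [Fintype V] (H : SimpleGraph V) : Finset (Sym2 V) :=
  (Set.toFinite H.edgeSet).toFinset

open Classical in
/-- The probability that exactly the edges in `R` are realized, when each edge `e` of `H` is
realized independently with probability `p e`. -/
noncomputable def realizationWeight {V : Type u} [Fintype V] (H : SimpleGraph V)
    (p : Sym2 V → unitInterval) (R : Finset (Sym2 V)) : ENNReal :=
  if R ⊆ edges H then
    ENNReal.ofReal (∏ e ∈ edges H, if e ∈ R then (p e : ℝ) else 1 - (p e : ℝ))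
  else 0

theorem sum_realizationWeight {V : Type u} [Fintype V] (H : SimpleGraph V)
    (p : Sym2 V → unitInterval) :
    ∑ R ∈ (edges H).powerset, realizationWeight H p R = 1 := by
  classical
  have h1 : ∀ R ∈ (edges H).powerset, realizationWeight H p R =
      ENNReal.ofReal ((∏ e ∈ R, (p e : ℝ)) * ∏ e ∈ edges H \ R, (1 - (p e : ℝ))) := by
    intro R hR
    have hR' := Finset.mem_powerset.1 hR
    rw [realizationWeight, if_pos hR', Finset.prod_ite, Finset.filter_mem_eq_inter,
      Finset.inter_eq_right.2 hR', Finset.filter_notMem_eq_sdiff]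
  rw [Finset.sum_congr rfl h1, ← ENNReal.ofReal_sum_of_nonneg, ← Finset.prod_add]
  · simp
  · intro R _
    exact mul_nonneg (Finset.prod_nonneg fun e _ => (p e).2.1)
      (Finset.prod_nonneg fun e _ => sub_nonneg.2 (p e).2.2)

/-- The law of the random set of realized edges: each edge `e` of `H` is present independently
with probability `p e`. -/
noncomputable def realizationLaw {V : Type u} [Fintype V] (H : SimpleGraph V)
    (p : Sym2 V → unitInterval) : PMF (Finset (Sym2 V)) :=
  PMF.ofFinset (realizationWeight H p) (edges H).powerset (sum_realizationWeight H p)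
    (fun R hR => by rw [realizationWeight, if_neg (fun h => hR (Finset.mem_powerset.2 h))])

/-- An input: a graph `H` with realization probabilities `p` (values of `p` off the edges of `H`
are irrelevant) and a randomized algorithm `MO` that, given the set `R` of realized edges,
returns a random matching of the realized graph. -/
structure Input (V : Type u) [Fintype V] where
  H : SimpleGraph V
  p : Sym2 V → unitInterval
  MO : Finset (Sym2 V) → PMF (Finset (Sym2 V))
  isMatching : ∀ R, R ⊆ edges H → ∀ M ∈ (MO R).support, IsMatchingOf R M

/-- The law of the random matching `M_O`, over the realization of the edges and the randomness of
the algorithm that finds it. -/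
noncomputable def Input.lawMO {V : Type u} [Fintype V] (I : Input V) : PMF (Finset (Sym2 V)) :=
  (realizationLaw I.H I.p).bind I.MO

/-! ### Randomized matching algorithms -/

/-- What a matching algorithm returns: a set of edges `Mc` and a set of vertices `A`. -/
structure Output (V : Type u) where
  Mc : Finset (Sym2 V)
  A : Finset V

/-- A randomized algorithm: given an input and the set `R` of realized edges, it returns a random
output. It knows the randomized algorithm `MO`, hence the distribution of `M_O`, and the
realization `R`. (Letting it see a sample of `M_O` as well would give nothing more, as it can draw
one from `MO R` with its own randomness.) -/
structure RandomizedAlgorithm where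
  run : ∀ (V : Type u) [Fintype V], Input V → Finset (Sym2 V) → PMF (Output V)

/-- The law of the output, over the realization of the edges and the randomness of the
algorithm. -/
noncomputable def RandomizedAlgorithm.outLaw (B : RandomizedAlgorithm.{u}) {V : Type u} [Fintype V]
    (I : Input V) : PMF (Output V) :=
  (realizationLaw I.H I.p).bind (B.run V I)

open Classical in
/-- The random variable
`Z_v = ∑ x_e / Pr[{u, v} ⊆ A] * 1[u ∈ A]`, the sum over the edges `e = {u, v}` at `v` of the
complement of `H`, where `μ` is the law of the output. -/
noncomputable def Z {V : Type u} [Fintype V] (H : SimpleGraph V) (μ : PMF (Output V))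
    (x : Sym2 V → ℝ) (v : V) (o : Output V) : ℝ :=
  ∑ u ∈ nbrs Hᶜ v,
    x s(u, v) / prob μ (fun o' => u ∈ o'.A ∧ v ∈ o'.A) * (if u ∈ o.A then 1 else 0)

/-- `B` is an `α`-approximation variance-bounding matching algorithm. The constant `δ` depends on
nothing but the algorithm. The algorithm is not given the edge weights, so the approximation
guarantee is for every choice of nonnegative weights. -/
def RandomizedAlgorithm.IsVarianceBounding (B : RandomizedAlgorithm.{u}) (α : ℝ) : Prop :=
  ∃ δ : ℝ, 0 < δ ∧ δ < 1 ∧ ∀ (V : Type u) [Fintype V] (I : Input V),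
    -- `Mc` is a matching of the realized graph and no vertex of `A` is matched in it
    (∀ R, R ⊆ edges I.H → ∀ o ∈ (B.run V I R).support,
      IsMatchingOf R o.Mc ∧ ∀ v ∈ o.A, ¬ Covers o.Mc v) ∧
    -- `Mc` is in expectation an `α`-approximate matching with respect to `M_O`
    (∀ w : Sym2 V → ℝ, (∀ e ∈ edges I.H, 0 ≤ w e) →
      α * expect I.lawMO (fun M => ∑ e ∈ M, w e)
        ≤ expect (B.outLaw I) (fun o => ∑ e ∈ o.Mc, w e)) ∧
    -- `Pr[v ∈ A] ≥ Pr[v ∉ M_O]`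
    (∀ v : V, prob I.lawMO (fun M => ¬ Covers M v) ≤ prob (B.outLaw I) (fun o => v ∈ o.A)) ∧
    -- two vertices without an edge in `H` are both in `A` with probability at least `δ`
    (∀ u v : V, u ≠ v → ¬ I.H.Adj u v →
      δ ≤ prob (B.outLaw I) (fun o => u ∈ o.A ∧ v ∈ o.A)) ∧
    -- `Var(Z_v) ≤ 6 τ / δ ^ 2`
    (∀ τ : ℝ, 0 < τ → τ < 1 → ∀ x : Sym2 V → ℝ, IsFractionalMatching I.Hᶜ x →
      (∀ e ∈ I.Hᶜ.edgeSet, x e ≤ τ) →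
      ∀ v : V, var (B.outLaw I) (Z I.H (B.outLaw I) x v) ≤ 6 * τ / δ ^ 2)

end StochMatch

/-! Write `x` for the edge marginals of `M_O` and X_v for the sum of `x` at `v`. The algorithm picks
one of three mechanisms at random, with probabilities 0.69, 0.17 and 0.14. Each puts `v` into `A`
with the same probability 1 - (1 - θ) X_v, where θ = 1/2000.

Two of them are contention resolution schemes. Vertices arrive in a fixed order. An arriving vertex
reveals its edges to earlier vertices, samples all other edges afresh, runs `MO`, and proposes along
its edge in that matching, if any. Distinct arrivals reveal disjoint batches, so the proposals are
independent (`Input.bind_arrival`). Accepting with the right probability matches each edge with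
probability exactly α times `x`, if α is feasible for the order. The third mechanism (`Input.thin`)
draws `A` independently and keeps the edges of a sample of `M_O` that avoid `A`. It contributes
about 0.14 X_u X_v to the share of the edge, and it alone bounds Pr[{u, v} ⊆ A] from below.

To reach 8/15, water filling (`exists_levels`) gives vertex levels K ≤ 2/3 with K_v + ∑ max(K_v,
K_w) x_vw ≤ 1, with equality below the cap. Arrival by decreasing level realizes the shares max(K_u,
K_v). What 8/15 still lacks is the `residual`. It is feasible, after division by 0.17, for arrival
by increasing level (`IsLevels.residual_add_sum_le`): a vertex below the cap must have large X_v, so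
the third mechanism serves it well.

For the variance, all acceptance probabilities are at most 1 - θ, so correlations die out: a
potential argument (`potential_step`, `Input.sum_abs_freeCov_le`) bounds every row sum of absolute
covariances by a constant depending only on θ. Since the three mechanisms share their marginals, the
mixture inherits the bound. -/

namespace StochMatch

open MeasureTheory ProbabilityTheory

/-! ### Expectations under finite discrete distributions -/

section Expect

variable {α β : Type*}

/-- The indicator of a proposition, as a real number. -/
noncomputable def ind (P : Prop) : ℝ := by
  classical exact if P then 1 else 0

theorem ind_true {P : Prop} (h : P) : ind P = 1 := by simp [ind, h]

theorem ind_false {P : Prop} (h : ¬ P) : ind P = 0 := by simp [ind, h]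

theorem ind_nonneg (P : Prop) : 0 ≤ ind P := by
  by_cases h : P <;> simp [ind, h]

theorem ind_le_one (P : Prop) : ind P ≤ 1 := by
  by_cases h : P <;> simp [ind, h]

theorem ind_not (P : Prop) : ind (¬ P) = 1 - ind P := by
  by_cases h : P <;> simp [ind, h]

theorem ind_and (P Q : Prop) : ind (P ∧ Q) = ind P * ind Q := by
  by_cases h : P <;> by_cases h' : Q <;> simp [ind, h, h']

theorem ind_mul_self (P : Prop) : ind P * ind P = ind P := by
  by_cases h : P <;> simp [ind, h]

theorem ind_congr {P Q : Prop} (h : P ↔ Q) : ind P = ind Q := by rw [propext h]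

theorem ind_eq_ite (P : Prop) [Decidable P] : ind P = if P then 1 else 0 := by
  by_cases h : P <;> simp [ind, h]

theorem expect_eq_sum [Fintype α] (μ : PMF α) (X : α → ℝ) :
    expect μ X = ∑ a, (μ a).toReal * X a := by
  let _ : MeasurableSpace α := ⊤
  exact PMF.integral_eq_sum μ X

theorem prob_eq_expect [Finite α] (μ : PMF α) (P : α → Prop) :
    prob μ P = expect μ fun a => ind (P a) := by
  classical
  have := Fintype.ofFinite α
  let _ : MeasurableSpace α := ⊤
  have h : (fun a => ind (P a)) = Set.indicator {a | P a} 1 := by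
    funext a
    by_cases h : P a <;> simp [ind, h]
  rw [expect, h, integral_indicator_one]
  · rfl
  · trivial

theorem var_eq_expect [Finite α] (μ : PMF α) (X : α → ℝ) :
    var μ X = expect μ fun a => (X a - expect μ X) ^ 2 := by
  have := Fintype.ofFinite α
  let _ : MeasurableSpace α := ⊤
  exact variance_eq_integral (measurable_of_finite X).aemeasurable

theorem sum_toReal_eq_one [Fintype α] (μ : PMF α) : ∑ a, (μ a).toReal = 1 := by
  rw [← ENNReal.toReal_sum fun a _ => μ.apply_ne_top a, ← tsum_fintype (L := .unconditional α),
    μ.tsum_coe, ENNReal.toReal_one]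

theorem expect_pure [Finite α] (a : α) (X : α → ℝ) : expect (PMF.pure a) X = X a := by
  classical
  have := Fintype.ofFinite α
  rw [expect_eq_sum, Finset.sum_eq_single a] <;> simp +contextual [PMF.pure_apply]

theorem expect_bind [Finite α] [Finite β] (μ : PMF α) (κ : α → PMF β) (X : β → ℝ) :
    expect (μ.bind κ) X = expect μ fun a => expect (κ a) X := by
  have := Fintype.ofFinite α
  have := Fintype.ofFinite β
  simp only [expect_eq_sum, PMF.bind_apply, tsum_fintype, Finset.mul_sum]
  rw [Finset.sum_comm]
  refine Finset.sum_congr rfl fun b _ => ?_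
  rw [ENNReal.toReal_sum
    fun a _ => ENNReal.mul_ne_top (μ.apply_ne_top a) ((κ a).apply_ne_top b), Finset.sum_mul]
  simp only [ENNReal.toReal_mul, mul_assoc]

theorem expect_congr [Finite α] {μ : PMF α} {X Y : α → ℝ} (h : ∀ a ∈ μ.support, X a = Y a) :
    expect μ X = expect μ Y := by
  have := Fintype.ofFinite α
  simp only [expect_eq_sum]
  refine Finset.sum_congr rfl fun a _ => ?_
  by_cases ha : μ a = 0
  · simp [ha]
  · rw [h a ((μ.mem_support_iff a).2 ha)]

theorem expect_mono [Finite α] {μ : PMF α} {X Y : α → ℝ} (h : ∀ a ∈ μ.support, X a ≤ Y a) :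
    expect μ X ≤ expect μ Y := by
  have := Fintype.ofFinite α
  simp only [expect_eq_sum]
  refine Finset.sum_le_sum fun a _ => ?_
  by_cases ha : μ a = 0
  · simp [ha]
  · exact mul_le_mul_of_nonneg_left (h a ((μ.mem_support_iff a).2 ha)) ENNReal.toReal_nonneg

theorem expect_add [Finite α] (μ : PMF α) (X Y : α → ℝ) :
    expect μ (fun a => X a + Y a) = expect μ X + expect μ Y := by
  have := Fintype.ofFinite α
  simp only [expect_eq_sum, mul_add, Finset.sum_add_distrib]

theorem expect_sub [Finite α] (μ : PMF α) (X Y : α → ℝ) :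
    expect μ (fun a => X a - Y a) = expect μ X - expect μ Y := by
  have := Fintype.ofFinite α
  simp only [expect_eq_sum, mul_sub, Finset.sum_sub_distrib]

theorem expect_const_mul [Finite α] (μ : PMF α) (c : ℝ) (X : α → ℝ) :
    expect μ (fun a => c * X a) = c * expect μ X := by
  have := Fintype.ofFinite α
  simp only [expect_eq_sum, Finset.mul_sum, mul_left_comm]

theorem expect_mul_const [Finite α] (μ : PMF α) (c : ℝ) (X : α → ℝ) :
    expect μ (fun a => X a * c) = expect μ X * c := by
  simp only [mul_comm _ c, expect_const_mul]

theorem expect_sum [Finite α] {ι : Type*} (μ : PMF α) (s : Finset ι) (X : ι → α → ℝ) :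
    expect μ (fun a => ∑ i ∈ s, X i a) = ∑ i ∈ s, expect μ (X i) := by
  have := Fintype.ofFinite α
  simp only [expect_eq_sum, Finset.mul_sum]
  exact Finset.sum_comm

theorem expect_const [Finite α] (μ : PMF α) (c : ℝ) : expect μ (fun _ => c) = c := by
  have := Fintype.ofFinite α
  rw [expect_eq_sum, ← Finset.sum_mul, sum_toReal_eq_one, one_mul]

theorem expect_nonneg [Finite α] {μ : PMF α} {X : α → ℝ} (h : ∀ a ∈ μ.support, 0 ≤ X a) :
    0 ≤ expect μ X := by
  rw [← expect_const μ 0]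
  exact expect_mono h

theorem prob_nonneg [Finite α] (μ : PMF α) (P : α → Prop) : 0 ≤ prob μ P := by
  rw [prob_eq_expect]
  exact expect_nonneg fun a _ => ind_nonneg _

theorem prob_le_one [Finite α] (μ : PMF α) (P : α → Prop) : prob μ P ≤ 1 := by
  rw [prob_eq_expect, ← expect_const μ 1]
  exact expect_mono fun a _ => ind_le_one _

/-- The variance is at most the second moment about any point. -/
theorem var_le_expect_sub_sq [Finite α] (μ : PMF α) (X : α → ℝ) (c : ℝ) :
    var μ X ≤ expect μ fun a => (X a - c) ^ 2 := by
  have h : expect μ (fun a => (X a - c) ^ 2) =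
      var μ X + (expect μ X - c) ^ 2 := by
    rw [var_eq_expect]
    have h1 : (fun a => (X a - c) ^ 2) = fun a => (X a - expect μ X) ^ 2 +
        ((2 * (expect μ X - c)) * (X a - expect μ X) + (expect μ X - c) ^ 2) := by
      funext a; ring
    rw [h1, expect_add, expect_add, expect_const, expect_const_mul, expect_sub, expect_const]
    ring
  rw [h]
  nlinarith [sq_nonneg (expect μ X - c)]

end Expect

/-! ### Random subsets with independent memberships -/

section Bernoulli

variable {α : Type*}

open Classical in
/-- The probability that the random subset of `E` that contains each `e` independently with
probability `q e` equals `R`. -/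
noncomputable def bernoulliWeight (q : α → unitInterval) (E R : Finset α) : ENNReal :=
  if R ⊆ E then ENNReal.ofReal (∏ e ∈ E, if e ∈ R then (q e : ℝ) else 1 - (q e : ℝ)) else 0

theorem sum_bernoulliWeight (q : α → unitInterval) (E : Finset α) :
    ∑ R ∈ E.powerset, bernoulliWeight q E R = 1 := by
  classical
  have h1 : ∀ R ∈ E.powerset, bernoulliWeight q E R =
      ENNReal.ofReal ((∏ e ∈ R, (q e : ℝ)) * ∏ e ∈ E \ R, (1 - (q e : ℝ))) := by
    intro R hR
    have hR' := Finset.mem_powerset.1 hR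
    rw [bernoulliWeight, if_pos hR', Finset.prod_ite, Finset.filter_mem_eq_inter,
      Finset.inter_eq_right.2 hR', Finset.filter_notMem_eq_sdiff]
  rw [Finset.sum_congr rfl h1, ← ENNReal.ofReal_sum_of_nonneg, ← Finset.prod_add]
  · simp
  · intro R _
    exact mul_nonneg (Finset.prod_nonneg fun e _ => (q e).2.1)
      (Finset.prod_nonneg fun e _ => sub_nonneg.2 (q e).2.2)

/-- The law of the random subset of `E` that contains each `e` independently with probability
`q e`. -/
noncomputable def bernoulliSubset (q : α → unitInterval) (E : Finset α) : PMF (Finset α) :=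
  PMF.ofFinset (bernoulliWeight q E) E.powerset (sum_bernoulliWeight q E)
    (fun R hR => by rw [bernoulliWeight, if_neg (fun h => hR (Finset.mem_powerset.2 h))])

theorem realizationLaw_eq {V : Type u} [Fintype V] (H : SimpleGraph V)
    (p : Sym2 V → unitInterval) : realizationLaw H p = bernoulliSubset p (edges H) := by
  ext R
  change realizationWeight H p R = bernoulliWeight p (edges H) R
  unfold realizationWeight bernoulliWeight
  congr
  funext e
  congr

theorem bernoulliSubset_apply (q : α → unitInterval) (E R : Finset α) :
    bernoulliSubset q E R = bernoulliWeight q E R := rfl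

theorem subset_of_mem_support {q : α → unitInterval} {E R : Finset α}
    (h : R ∈ (bernoulliSubset q E).support) : R ⊆ E := by
  by_contra hR
  exact (PMF.mem_support_iff _ _).1 h (by rw [bernoulliSubset_apply, bernoulliWeight, if_neg hR])

theorem bernoulliWeight_union [DecidableEq α] (q : α → unitInterval) {E₁ E₂ : Finset α}
    (h : Disjoint E₁ E₂) {R₁ R₂ : Finset α} (h₁ : R₁ ⊆ E₁) (h₂ : R₂ ⊆ E₂) :
    bernoulliWeight q (E₁ ∪ E₂) (R₁ ∪ R₂) = bernoulliWeight q E₁ R₁ * bernoulliWeight q E₂ R₂ := by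
  classical
  rw [bernoulliWeight, bernoulliWeight, bernoulliWeight, if_pos h₁, if_pos h₂,
    if_pos (Finset.union_subset_union h₁ h₂), ← ENNReal.ofReal_mul]
  · rw [Finset.prod_union h]
    congr 2
    · refine Finset.prod_congr rfl fun e he => ?_
      have : e ∉ R₂ := fun h' => Finset.disjoint_left.1 h he (h₂ h')
      simp [this]
    · refine Finset.prod_congr rfl fun e he => ?_
      have : e ∉ R₁ := fun h' => Finset.disjoint_left.1 h (h₁ h') he
      simp [this]
  · refine Finset.prod_nonneg fun e _ => ?_
    split_ifs
    · exact (q e).2.1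
    · exact sub_nonneg.2 (q e).2.2

/-- The form in which independence is used: disjoint blocks can be sampled one after the other. -/
theorem bernoulliSubset_union [DecidableEq α] (q : α → unitInterval) {E₁ E₂ : Finset α}
    (h : Disjoint E₁ E₂) :
    bernoulliSubset q (E₁ ∪ E₂) = (bernoulliSubset q E₁).bind fun R₁ =>
      (bernoulliSubset q E₂).bind fun R₂ => PMF.pure (R₁ ∪ R₂) := by
  have key : ∀ R₁ R₂ R : Finset α, R₁ ⊆ E₁ → R₂ ⊆ E₂ → R = R₁ ∪ R₂ →
      R ∩ E₁ = R₁ ∧ R ∩ E₂ = R₂ := by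
    rintro R₁ R₂ R h₁ h₂ rfl
    have hd := Finset.disjoint_left.1 h
    constructor <;> ext e <;> simp only [Finset.mem_inter, Finset.mem_union]
    · exact ⟨fun ⟨h3, h4⟩ => h3.resolve_right fun h5 => hd h4 (h₂ h5), fun h3 => ⟨.inl h3, h₁ h3⟩⟩
    · exact ⟨fun ⟨h3, h4⟩ => h3.resolve_left fun h5 => hd (h₁ h5) h4, fun h3 => ⟨.inr h3, h₂ h3⟩⟩
  have hz : ∀ E R : Finset α, ¬ R ⊆ E → bernoulliSubset q E R = 0 := fun E R hR => by
    rw [bernoulliSubset_apply, bernoulliWeight, if_neg hR]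
  ext R
  simp only [PMF.bind_apply, PMF.pure_apply]
  rw [tsum_eq_single (R ∩ E₁), tsum_eq_single (R ∩ E₂)]
  · by_cases hR : R ⊆ E₁ ∪ E₂
    · have hU : R = R ∩ E₁ ∪ R ∩ E₂ := by
        rw [← Finset.inter_union_distrib_left, Finset.inter_eq_left.2 hR]
      rw [if_pos hU, mul_one]
      conv_lhs => rw [hU]
      exact bernoulliWeight_union q h Finset.inter_subset_right Finset.inter_subset_right
    · rw [hz _ _ hR, if_neg, mul_zero, mul_zero]
      intro hU
      rw [← Finset.inter_union_distrib_left] at hU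
      exact hR (Finset.inter_eq_left.1 hU.symm)
  · intro R₂ hR₂
    by_cases h₂ : R₂ ⊆ E₂
    · rw [if_neg, mul_zero]
      exact fun hU => hR₂ (key _ _ _ Finset.inter_subset_right h₂ hU).2.symm
    · rw [hz _ _ h₂, zero_mul]
  · intro R₁ hR₁
    by_cases h₁ : R₁ ⊆ E₁
    · rw [ENNReal.tsum_eq_zero.2, mul_zero]
      intro R₂
      by_cases h₂ : R₂ ⊆ E₂
      · rw [if_neg, mul_zero]
        exact fun hU => hR₁ (key _ _ _ h₁ h₂ hU).1.symm
      · rw [hz _ _ h₂, zero_mul]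
    · rw [hz _ _ h₁, zero_mul]

theorem expect_bernoulliSubset_singleton [Finite α] (q : α → unitInterval) (a : α)
    (f : Finset α → ℝ) :
    expect (bernoulliSubset q {a}) f = q a * f {a} + (1 - q a) * f ∅ := by
  classical
  have := Fintype.ofFinite α
  rw [expect_eq_sum]
  have hs : ∑ R : Finset α, (bernoulliSubset q {a} R).toReal * f R =
      ∑ R ∈ ({∅, {a}} : Finset (Finset α)), (bernoulliSubset q {a} R).toReal * f R := by
    refine (Finset.sum_subset (Finset.subset_univ _) fun R _ hR => ?_).symm
    have : ¬ R ⊆ {a} := by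
      intro h
      rcases Finset.subset_singleton_iff.1 h with h | h <;> simp [h] at hR
    rw [bernoulliSubset_apply, bernoulliWeight, if_neg this]
    simp
  rw [hs, Finset.sum_pair (Finset.singleton_ne_empty a).symm]
  simp only [bernoulliSubset_apply, bernoulliWeight]
  have h1 : (0 : ℝ) ≤ q a := (q a).2.1
  have h2 : (0 : ℝ) ≤ 1 - q a := sub_nonneg.2 (q a).2.2
  simp [ENNReal.toReal_ofReal, h1, h2]
  ring

/-- Conditioning on the membership of one element. -/
theorem expect_bernoulliSubset_of_mem [Finite α] [DecidableEq α] (q : α → unitInterval)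
    {E : Finset α} {a : α} (ha : a ∈ E) (f : Finset α → ℝ) :
    expect (bernoulliSubset q E) f =
      q a * expect (bernoulliSubset q (E.erase a)) (fun R => f (insert a R)) +
      (1 - q a) * expect (bernoulliSubset q (E.erase a)) f := by
  have hE : E = {a} ∪ E.erase a := by
    rw [← Finset.insert_eq, Finset.insert_erase ha]
  conv_lhs => rw [hE, bernoulliSubset_union q (by simp)]
  rw [expect_bind, expect_bernoulliSubset_singleton]
  simp only [expect_bind, expect_pure, Finset.empty_union, ← Finset.insert_eq]

theorem expect_ind_mem_bernoulliSubset [Finite α] (q : α → unitInterval) {E : Finset α} {a : α}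
    (ha : a ∈ E) : expect (bernoulliSubset q E) (fun R => ind (a ∈ R)) = q a := by
  classical
  rw [expect_bernoulliSubset_of_mem q ha]
  have h1 : expect (bernoulliSubset q (E.erase a)) (fun R => ind (a ∈ R)) = 0 := by
    rw [← expect_const (bernoulliSubset q (E.erase a)) 0]
    refine expect_congr fun R hR => ind_false fun h => ?_
    simpa using subset_of_mem_support hR h
  rw [h1, expect_congr (Y := fun _ => 1) fun R _ => ind_true (Finset.mem_insert_self a R),
    expect_const]
  ring

theorem expect_ind_mem_mul_bernoulliSubset [Finite α] (q : α → unitInterval) {E : Finset α}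
    {a b : α} (ha : a ∈ E) (hb : b ∈ E) (hab : a ≠ b) :
    expect (bernoulliSubset q E) (fun R => ind (a ∈ R) * ind (b ∈ R)) = q a * q b := by
  classical
  rw [expect_bernoulliSubset_of_mem q ha]
  have h1 : expect (bernoulliSubset q (E.erase a)) (fun R => ind (a ∈ R) * ind (b ∈ R)) = 0 := by
    rw [← expect_const (bernoulliSubset q (E.erase a)) 0]
    refine expect_congr fun R hR => ?_
    rw [ind_false fun h => by simpa using subset_of_mem_support hR h, zero_mul]
  rw [h1, expect_congr (Y := fun R => ind (b ∈ R)) fun R _ => by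
    rw [ind_true (Finset.mem_insert_self a R), one_mul]
    exact ind_congr (by simp [hab.symm]),
    expect_ind_mem_bernoulliSubset q (Finset.mem_erase.2 ⟨hab.symm, hb⟩)]
  ring

end Bernoulli

/-! ### Vertices arriving one by one -/

theorem bind_congr {α β : Type*} {μ : PMF α} {f g : α → PMF β}
    (h : ∀ a ∈ μ.support, f a = g a) : μ.bind f = μ.bind g := by
  refine PMF.ext fun b => ?_
  rw [PMF.bind_apply, PMF.bind_apply]
  refine tsum_congr fun a => ?_
  by_cases ha : a ∈ μ.support
  · rw [h a ha]
  · rw [(PMF.apply_eq_zero_iff _ _).2 ha, zero_mul, zero_mul]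

section Arrival

open Classical

theorem covers_insert {V : Type u} {N : Finset (Sym2 V)} {e : Sym2 V} {w : V} :
    Covers (insert e N) w ↔ w ∈ e ∨ Covers N w := by
  simp [Covers]

theorem isMatchingOf_empty {V : Type u} (R : Finset (Sym2 V)) : IsMatchingOf R (∅ : Finset (Sym2 V)) :=
  ⟨Finset.empty_subset _, by simp⟩

variable {V : Type u} [Fintype V]

theorem mem_edges {H : SimpleGraph V} {u v : V} : s(u, v) ∈ edges H ↔ H.Adj u v := by
  simp [edges]

/-- The edges of `H` from `v` to the vertices in `l`. -/
noncomputable def batch (H : SimpleGraph V) (v : V) (l : List V) : Finset (Sym2 V) :=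
  (edges H).filter fun e => ∃ u ∈ l, e = s(u, v)

/-- The edges of `H` inside `l`. -/
noncomputable def innerEdges (H : SimpleGraph V) (l : List V) : Finset (Sym2 V) :=
  (edges H).filter fun e => ∀ w ∈ e, w ∈ l

/-- The edges of `M` from `v` to the vertices of `l` that lie in `T`. -/
noncomputable def proposals (H : SimpleGraph V) (v : V) (l : List V) (M : Finset (Sym2 V))
    (T : Finset V) : Finset (Sym2 V) :=
  (batch H v l).filter fun e => e ∈ M ∧ ∃ u ∈ T, e = s(u, v)

/-- Add to `N` the edges of `P` with both endpoints unmatched in `N`. -/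
noncomputable def extend (N P : Finset (Sym2 V)) : Finset (Sym2 V) :=
  N ∪ P.filter fun e => ∀ w ∈ e, ¬ Covers N w

/-- The arriving vertex `v` proposes along at most one of its realized edges to the earlier
vertices `l`: all the other edges are sampled afresh, `MO` is run, and its edge from `v` to `u ∈ l`
is retained with probability `a u`. -/
noncomputable def Input.propose (I : Input V) (a : V → unitInterval) (v : V) (l : List V)
    (R : Finset (Sym2 V)) : PMF (Finset (Sym2 V)) :=
  (bernoulliSubset I.p (edges I.H \ batch I.H v l)).bind fun R' =>
    (I.MO (R ∩ batch I.H v l ∪ R')).bind fun M =>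
      (bernoulliSubset a Finset.univ).bind fun T => PMF.pure (proposals I.H v l M T)

/-- The matching built when the vertices of the list arrive one by one, the head being the last to
arrive, and `R` is the set of realized edges. -/
noncomputable def Input.arrival (I : Input V) (a : V → List V → V → unitInterval)
    (R : Finset (Sym2 V)) : List V → PMF (Finset (Sym2 V))
  | [] => PMF.pure ∅
  | v :: l => (I.arrival a R l).bind fun N =>
      (I.propose (a v l) v l R).bind fun P => PMF.pure (extend N P)

/-- The law of the proposals of `v` when the realization is random. -/
noncomputable def Input.freshPropose (I : Input V) (a : V → unitInterval) (v : V) (l : List V) :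
    PMF (Finset (Sym2 V)) :=
  I.lawMO.bind fun M =>
    (bernoulliSubset a Finset.univ).bind fun T => PMF.pure (proposals I.H v l M T)

/-- The matching built with independent fresh proposals. -/
noncomputable def Input.freshArrival (I : Input V) (a : V → List V → V → unitInterval) :
    List V → PMF (Finset (Sym2 V))
  | [] => PMF.pure ∅
  | v :: l => (I.freshArrival a l).bind fun N =>
      (I.freshPropose (a v l) v l).bind fun P => PMF.pure (extend N P)

theorem mem_batch {H : SimpleGraph V} {v : V} {l : List V} {e : Sym2 V} :
    e ∈ batch H v l ↔ ∃ u ∈ l, e = s(u, v) ∧ H.Adj u v := by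
  simp only [batch, Finset.mem_filter]
  constructor
  · rintro ⟨he, u, hu, rfl⟩
    exact ⟨u, hu, rfl, mem_edges.1 he⟩
  · rintro ⟨u, hu, rfl, h⟩
    exact ⟨mem_edges.2 h, u, hu, rfl⟩

theorem batch_subset (H : SimpleGraph V) (v : V) (l : List V) : batch H v l ⊆ edges H :=
  Finset.filter_subset _ _

theorem batch_subset_innerEdges (H : SimpleGraph V) (v : V) (l : List V) :
    batch H v l ⊆ innerEdges H (v :: l) := by
  intro e he
  refine Finset.mem_filter.2 ⟨batch_subset _ _ _ he, ?_⟩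
  obtain ⟨u, hu, rfl, -⟩ := mem_batch.1 he
  intro w hw
  rcases Sym2.mem_iff.1 hw with rfl | rfl <;> simp [hu]

theorem innerEdges_subset_cons (H : SimpleGraph V) (v : V) (l : List V) :
    innerEdges H l ⊆ innerEdges H (v :: l) := by
  intro e he
  obtain ⟨h1, h2⟩ := Finset.mem_filter.1 he
  exact Finset.mem_filter.2 ⟨h1, fun w hw => List.mem_cons_of_mem _ (h2 w hw)⟩

theorem disjoint_batch_innerEdges (H : SimpleGraph V) {v : V} {l : List V} (hv : v ∉ l) :
    Disjoint (batch H v l) (innerEdges H l) := by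
  refine Finset.disjoint_left.2 fun e he he' => hv ?_
  obtain ⟨u, -, rfl, -⟩ := mem_batch.1 he
  exact (Finset.mem_filter.1 he').2 v (by simp)

/-- A matching has at most one edge at `v`, so `v` makes at most one proposal. -/
theorem proposals_eq (H : SimpleGraph V) (v : V) (l : List V) {R M : Finset (Sym2 V)}
    (hM : IsMatchingOf R M) (T : Finset V) :
    proposals H v l M T = ∅ ∨
      ∃ u ∈ l, H.Adj u v ∧ s(u, v) ∈ M ∧ proposals H v l M T = {s(u, v)} := by
  rcases Finset.eq_empty_or_nonempty (proposals H v l M T) with h | ⟨e, he⟩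
  · exact .inl h
  · obtain ⟨h1, h2, u', -, -⟩ := Finset.mem_filter.1 he
    obtain ⟨u, hu, rfl, huv⟩ := mem_batch.1 h1
    refine .inr ⟨u, hu, huv, h2, Finset.eq_singleton_iff_unique_mem.2 ⟨he, fun e' he' => ?_⟩⟩
    obtain ⟨-, h4, w, -, rfl⟩ := Finset.mem_filter.1 he'
    exact hM.2 _ h4 _ h2 v (by simp) (by simp)

/-- The resampled edges avoid the batch and a proposal lies in the batch, so it is an edge that is
really present, never a resampled one. -/
theorem Input.propose_support (I : Input V) (a : V → unitInterval) (v : V) (l : List V)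
    (R : Finset (Sym2 V)) {P : Finset (Sym2 V)} (hP : P ∈ (I.propose a v l R).support) :
    P = ∅ ∨ ∃ u ∈ l, I.H.Adj u v ∧ s(u, v) ∈ R ∧ P = {s(u, v)} := by
  simp only [Input.propose, PMF.mem_support_bind_iff, PMF.mem_support_pure_iff] at hP
  obtain ⟨R', hR', M, hM, T, -, rfl⟩ := hP
  have hR' := subset_of_mem_support hR'
  have hM := I.isMatching _ (Finset.union_subset (Finset.inter_subset_right.trans
    (batch_subset _ _ _)) (hR'.trans Finset.sdiff_subset)) _ hM
  rcases proposals_eq I.H v l hM T with h | ⟨u, hu, huv, he, h⟩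
  · exact .inl h
  · refine .inr ⟨u, hu, huv, ?_, h⟩
    have hb : s(u, v) ∈ batch I.H v l := mem_batch.2 ⟨u, hu, rfl, huv⟩
    rcases Finset.mem_union.1 (hM.1 he) with h' | h'
    · exact (Finset.mem_inter.1 h').1
    · exact absurd hb (Finset.mem_sdiff.1 (hR' h')).2

theorem extend_empty (N : Finset (Sym2 V)) : extend N ∅ = N := by simp [extend]

theorem extend_singleton_of_covers {N : Finset (Sym2 V)} {u v : V} (h : Covers N u) :
    extend N {s(u, v)} = N := by
  rw [extend, Finset.filter_singleton, if_neg, Finset.union_empty]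
  exact fun h' => h' u (by simp) h

theorem extend_singleton_of_not_covers {N : Finset (Sym2 V)} {u v : V} (h : ¬ Covers N u)
    (hv : ¬ Covers N v) : extend N {s(u, v)} = insert s(u, v) N := by
  rw [extend, Finset.filter_singleton, if_pos, Finset.union_comm, ← Finset.insert_eq]
  intro w hw
  rcases Sym2.mem_iff.1 hw with rfl | rfl <;> assumption

theorem isMatchingOf_extend_singleton {R N : Finset (Sym2 V)} (hN : IsMatchingOf R N) {u v : V}
    (he : s(u, v) ∈ R) (hv : ¬ Covers N v) : IsMatchingOf R (extend N {s(u, v)}) := by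
  by_cases hu : Covers N u
  · rwa [extend_singleton_of_covers hu]
  · rw [extend_singleton_of_not_covers hu hv]
    refine ⟨Finset.insert_subset he hN.1, ?_⟩
    have key : ∀ e ∈ N, ∀ w ∈ s(u, v), w ∉ e := by
      intro e he' w hw hwe
      rcases Sym2.mem_iff.1 hw with rfl | rfl
      exacts [hu ⟨e, he', hwe⟩, hv ⟨e, he', hwe⟩]
    intro e he e' he' w hw hw'
    rcases Finset.mem_insert.1 he with rfl | he <;> rcases Finset.mem_insert.1 he' with rfl | he'
    · rfl
    · exact absurd hw' (key _ he' w hw)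
    · exact absurd hw (key _ he w hw')
    · exact hN.2 _ he _ he' w hw hw'

theorem Input.arrival_support (I : Input V) (a : V → List V → V → unitInterval)
    (R : Finset (Sym2 V)) {l : List V} (hl : l.Nodup) {N : Finset (Sym2 V)}
    (hN : N ∈ (I.arrival a R l).support) :
    IsMatchingOf R N ∧ ∀ w, Covers N w → w ∈ l := by
  induction l generalizing N with
  | nil =>
    rw [Input.arrival, PMF.mem_support_pure_iff] at hN
    subst hN
    exact ⟨isMatchingOf_empty R, by simp [Covers]⟩
  | cons v l ih =>
    simp only [Input.arrival, PMF.mem_support_bind_iff, PMF.mem_support_pure_iff] at hN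
    obtain ⟨N', hN', P, hP, rfl⟩ := hN
    obtain ⟨hv, hl⟩ := List.nodup_cons.1 hl
    obtain ⟨h1, h2⟩ := ih hl hN'
    have hv' : ¬ Covers N' v := fun h => hv (h2 v h)
    rcases I.propose_support _ _ _ _ hP with rfl | ⟨u, hu, huv, he, rfl⟩
    · rw [extend_empty]
      exact ⟨h1, fun w hw => List.mem_cons_of_mem _ (h2 w hw)⟩
    · refine ⟨isMatchingOf_extend_singleton h1 he hv', fun w hw => ?_⟩
      by_cases hu' : Covers N' u
      · rw [extend_singleton_of_covers hu'] at hw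
        exact List.mem_cons_of_mem _ (h2 w hw)
      · rw [extend_singleton_of_not_covers hu' hv', covers_insert] at hw
        rcases hw with hw | hw
        · rcases Sym2.mem_iff.1 hw with rfl | rfl <;> simp [hu]
        · exact List.mem_cons_of_mem _ (h2 w hw)

theorem Input.propose_congr (I : Input V) (a : V → unitInterval) (v : V) (l : List V)
    {R R' : Finset (Sym2 V)} (h : ∀ e ∈ batch I.H v l, e ∈ R ↔ e ∈ R') :
    I.propose a v l R = I.propose a v l R' := by
  have : R ∩ batch I.H v l = R' ∩ batch I.H v l := by
    ext e
    simp only [Finset.mem_inter]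
    exact and_congr_left fun he => h e he
  rw [Input.propose, Input.propose, this]

theorem Input.arrival_congr (I : Input V) (a : V → List V → V → unitInterval) (l : List V)
    {R R' : Finset (Sym2 V)} (h : ∀ e ∈ innerEdges I.H l, e ∈ R ↔ e ∈ R') :
    I.arrival a R l = I.arrival a R' l := by
  induction l with
  | nil => rfl
  | cons v l ih =>
    rw [Input.arrival, Input.arrival, ih fun e he => h e (innerEdges_subset_cons _ _ _ he),
      I.propose_congr _ v l fun e he => h e (batch_subset_innerEdges _ _ _ he)]

/-- The true batch together with fresh edges outside it is distributed like a full realization, so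
`MO` run on it returns a sample of `M_O`. -/
theorem Input.bind_propose (I : Input V) (a : V → unitInterval) (v : V) (l : List V) :
    ((bernoulliSubset I.p (batch I.H v l)).bind fun R => I.propose a v l R) =
      I.freshPropose a v l := by
  have hE : edges I.H = batch I.H v l ∪ (edges I.H \ batch I.H v l) :=
    (Finset.union_sdiff_of_subset (batch_subset _ _ _)).symm
  rw [Input.freshPropose, Input.lawMO, realizationLaw_eq, hE,
    bernoulliSubset_union _ Finset.disjoint_sdiff]
  simp only [PMF.bind_bind, PMF.pure_bind, Input.propose]
  exact bind_congr fun R hR => by rw [Finset.inter_eq_left.2 (subset_of_mem_support hR)]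

/-- The batches of edges revealed at the arrivals are disjoint, so on a random realization the
proposals are independent. -/
theorem Input.bind_arrival (I : Input V) (a : V → List V → V → unitInterval) {l : List V}
    (hl : l.Nodup) {E : Finset (Sym2 V)} (hE : innerEdges I.H l ⊆ E) :
    ((bernoulliSubset I.p E).bind fun R => I.arrival a R l) = I.freshArrival a l := by
  induction l generalizing E with
  | nil => simp [Input.arrival, Input.freshArrival]
  | cons v l ih =>
    obtain ⟨hv, hl⟩ := List.nodup_cons.1 hl
    set B := batch I.H v l with hB
    have hBE : B ⊆ E := (batch_subset_innerEdges _ _ _).trans hE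
    have hE' : innerEdges I.H l ⊆ E \ B := by
      intro e he
      exact Finset.mem_sdiff.2 ⟨hE (innerEdges_subset_cons _ _ _ he), fun h =>
        Finset.disjoint_left.1 (disjoint_batch_innerEdges I.H hv) h he⟩
    have hU : E = (E \ B) ∪ B := (Finset.sdiff_union_of_subset hBE).symm
    rw [hU, bernoulliSubset_union _ Finset.sdiff_disjoint]
    simp only [PMF.bind_bind, PMF.pure_bind, Input.arrival, Input.freshArrival]
    rw [← ih hl hE', ← I.bind_propose, ← hB, PMF.bind_bind]
    -- The earlier arrivals see only edges inside `l`, and the proposal of `v` sees only its batch,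
    -- so each factor depends on one of the two independent parts.
    have h1 : ∀ R₁ ∈ (bernoulliSubset I.p (E \ B)).support,
        ∀ R₂ ∈ (bernoulliSubset I.p B).support,
        ((I.arrival a (R₁ ∪ R₂) l).bind fun N => (I.propose (a v l) v l (R₁ ∪ R₂)).bind fun P =>
          PMF.pure (extend N P)) =
        (I.arrival a R₁ l).bind fun N => (I.propose (a v l) v l R₂).bind fun P =>
          PMF.pure (extend N P) := by
      intro R₁ h₁ R₂ h₂
      have h₁ := subset_of_mem_support h₁
      have h₂ := subset_of_mem_support h₂
      rw [I.arrival_congr a l (R' := R₁), I.propose_congr _ v l (R' := R₂)]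
      · intro e he
        rw [Finset.mem_union, or_iff_right]
        exact fun h => (Finset.mem_sdiff.1 (h₁ h)).2 he
      · intro e he
        rw [Finset.mem_union, or_iff_left]
        exact fun h => Finset.disjoint_left.1 (disjoint_batch_innerEdges I.H hv) (h₂ h) he
    refine bind_congr fun R₁ hR₁ => ?_
    rw [bind_congr (h1 R₁ hR₁), PMF.bind_comm]
    refine congrArg _ (funext fun N => ?_)
    rw [PMF.bind_bind]

end Arrival

/-! ### First and second moments of the events that vertices are unmatched. -/

section Moments

open Classical

/-- The indicator that `u` is unmatched in `N`. -/
noncomputable def free {V : Type u} (N : Finset (Sym2 V)) (u : V) : ℝ := ind (¬ Covers N u)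

theorem free_insert {V : Type u} {N : Finset (Sym2 V)} {u v w : V} :
    free (insert s(u, v) N) w = if w = u ∨ w = v then 0 else free N w := by
  unfold free
  split_ifs with h
  · exact ind_false fun h' => h' (covers_insert.2 (.inl (Sym2.mem_iff.2 h)))
  · exact ind_congr (not_congr (by rw [covers_insert, Sym2.mem_iff, or_iff_right h]))

theorem free_mul_self {V : Type u} (N : Finset (Sym2 V)) (u : V) : free N u * free N u = free N u :=
  ind_mul_self _

variable {V : Type u} [Fintype V]

/-- The probability that the edge `s(u, v)` is in `M_O`. -/
noncomputable def Input.edgeProb (I : Input V) (u v : V) : ℝ :=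
  prob I.lawMO fun M => s(u, v) ∈ M

theorem Input.isMatchingOf_of_mem_support (I : Input V) {M : Finset (Sym2 V)}
    (hM : M ∈ I.lawMO.support) : IsMatchingOf (edges I.H) M := by
  simp only [Input.lawMO, PMF.mem_support_bind_iff, realizationLaw_eq] at hM
  obtain ⟨R, hR, hM⟩ := hM
  have h := I.isMatching R (subset_of_mem_support hR) M hM
  exact ⟨h.1.trans (subset_of_mem_support hR), h.2⟩

theorem Input.edgeProb_comm (I : Input V) (u v : V) : I.edgeProb u v = I.edgeProb v u := by
  simp only [Input.edgeProb, Sym2.eq_swap]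

theorem Input.edgeProb_nonneg (I : Input V) (u v : V) : 0 ≤ I.edgeProb u v := prob_nonneg _ _

theorem Input.edgeProb_of_not_adj (I : Input V) {u v : V} (h : ¬ I.H.Adj u v) :
    I.edgeProb u v = 0 := by
  rw [Input.edgeProb, prob_eq_expect, ← expect_const I.lawMO 0]
  exact expect_congr fun M hM => ind_false fun h' =>
    h (mem_edges.1 ((I.isMatchingOf_of_mem_support hM).1 h'))

theorem Input.edgeProb_self (I : Input V) (v : V) : I.edgeProb v v = 0 :=
  I.edgeProb_of_not_adj (I.H.loopless.irrefl v)

theorem ind_covers_eq_sum {R M : Finset (Sym2 V)} (hM : IsMatchingOf R M) (v : V) :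
    ind (Covers M v) = ∑ u, ind (s(u, v) ∈ M) := by
  by_cases h : Covers M v
  · obtain ⟨e, he, hve⟩ := h
    obtain ⟨u, rfl⟩ := Sym2.mem_iff_exists.1 hve
    rw [Sym2.eq_swap] at he
    rw [ind_true ⟨_, he, by simp⟩, Finset.sum_eq_single u]
    · rw [ind_true he]
    · intro w _ hw
      refine ind_false fun h => hw ?_
      have := hM.2 _ h _ he v (by simp) (by simp)
      exact Sym2.congr_left.1 this
    · simp
  · rw [ind_false h]
    exact (Finset.sum_eq_zero fun u _ => ind_false fun h' => h ⟨_, h', by simp⟩).symm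

theorem Input.prob_not_covers (I : Input V) (v : V) :
    prob I.lawMO (fun M => ¬ Covers M v) = 1 - ∑ u, I.edgeProb v u := by
  simp only [Input.edgeProb, prob_eq_expect, ind_not]
  rw [expect_sub, expect_const, ← expect_sum]
  congr 1
  refine expect_congr fun M hM => ?_
  rw [ind_covers_eq_sum (I.isMatchingOf_of_mem_support hM)]
  simp only [Sym2.eq_swap]

theorem Input.sum_edgeProb_le_one (I : Input V) (v : V) : ∑ u, I.edgeProb v u ≤ 1 := by
  have := I.prob_not_covers v
  linarith [prob_nonneg I.lawMO (fun M => ¬ Covers M v)]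

/-- As there is at most one proposal, any function of the proposal set is affine in the indicators
of the single proposals; its expectation then needs only their marginals. -/
theorem apply_proposals (H : SimpleGraph V) (v : V) (l : List V) {M : Finset (Sym2 V)}
    (hM : IsMatchingOf (edges H) M) (T : Finset V) (g : Finset (Sym2 V) → ℝ) :
    g (proposals H v l M T) = g ∅ +
      ∑ u ∈ l.toFinset, ind (s(u, v) ∈ M) * ind (u ∈ T) * (g {s(u, v)} - g ∅) := by
  by_cases h : ∃ u ∈ l, u ∈ T ∧ s(u, v) ∈ M
  · obtain ⟨u, hu, huT, huM⟩ := h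
    have hmem : s(u, v) ∈ proposals H v l M T :=
      Finset.mem_filter.2 ⟨mem_batch.2 ⟨u, hu, rfl, mem_edges.1 (hM.1 huM)⟩, huM, u, huT, rfl⟩
    have hP : proposals H v l M T = {s(u, v)} := by
      rcases proposals_eq H v l hM T with h | ⟨w, -, -, -, h⟩
      · simp [h] at hmem
      · rw [h, Finset.mem_singleton] at hmem
        rw [h, hmem]
    rw [hP, Finset.sum_eq_single u]
    · rw [ind_true huM, ind_true huT]
      ring
    · intro w _ hw
      rw [ind_false fun h => hw ?_]
      · ring
      · exact Sym2.congr_left.1 (hM.2 _ h _ huM v (by simp) (by simp))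
    · exact fun h => absurd (List.mem_toFinset.2 hu) h
  · have hP : proposals H v l M T = ∅ := by
      refine Finset.eq_empty_of_forall_notMem fun e he => ?_
      obtain ⟨h1, h2, w, hw, rfl⟩ := Finset.mem_filter.1 he
      obtain ⟨w', hw', hww, -⟩ := mem_batch.1 h1
      rw [← Sym2.congr_left.1 hww] at hw'
      exact h ⟨w, hw', hw, h2⟩
    rw [hP, Finset.sum_eq_zero, add_zero]
    intro u hu
    by_cases huT : u ∈ T
    · rw [ind_false fun hM => h ⟨u, List.mem_toFinset.1 hu, huT, hM⟩]
      ring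
    · rw [ind_false huT]
      ring

theorem Input.expect_freshPropose (I : Input V) (a : V → unitInterval) (v : V) (l : List V)
    (g : Finset (Sym2 V) → ℝ) :
    expect (I.freshPropose a v l) g = g ∅ +
      ∑ u ∈ l.toFinset, I.edgeProb u v * a u * (g {s(u, v)} - g ∅) := by
  simp only [Input.freshPropose, expect_bind, expect_pure]
  rw [expect_congr fun M hM => congrArg _ (funext fun T =>
    apply_proposals I.H v l (I.isMatchingOf_of_mem_support hM) T g)]
  simp only [expect_add, expect_const, expect_sum, expect_mul_const, expect_const_mul,
    expect_ind_mem_bernoulliSubset _ (Finset.mem_univ _), Input.edgeProb, prob_eq_expect]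

theorem Input.freshArrival_support (I : Input V) (a : V → List V → V → unitInterval) {l : List V}
    (hl : l.Nodup) {N : Finset (Sym2 V)} (hN : N ∈ (I.freshArrival a l).support) :
    ∀ w, Covers N w → w ∈ l := by
  rw [← I.bind_arrival a hl (Finset.filter_subset _ _ : _ ⊆ edges I.H),
    PMF.mem_support_bind_iff] at hN
  obtain ⟨R, -, hN⟩ := hN
  exact (I.arrival_support a R hl hN).2

/-- The probability that `v` proposes to `u`, when the earlier vertices are those of `l`. -/
noncomputable def Input.proposeProb (I : Input V) (a : V → List V → V → unitInterval) (v : V)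
    (l : List V) (u : V) : ℝ := I.edgeProb u v * a v l u

/-- The master recursion: the matching changes only if `v` proposes to some free `u`. Every moment
below comes from a choice of `φ`. -/
theorem Input.expect_freshArrival_cons (I : Input V) (a : V → List V → V → unitInterval) {v : V}
    {l : List V} (hl : (v :: l).Nodup) (φ : Finset (Sym2 V) → ℝ) :
    expect (I.freshArrival a (v :: l)) φ = expect (I.freshArrival a l) φ +
      ∑ u ∈ l.toFinset, I.proposeProb a v l u *
        expect (I.freshArrival a l) fun N => free N u * (φ (insert s(u, v) N) - φ N) := by
  obtain ⟨hv, hl⟩ := List.nodup_cons.1 hl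
  simp only [Input.freshArrival, expect_bind, expect_pure, I.expect_freshPropose, extend_empty]
  rw [expect_add, expect_sum]
  congr 1
  refine Finset.sum_congr rfl fun u _ => ?_
  rw [expect_const_mul]
  congr 1
  refine expect_congr fun N hN => ?_
  by_cases hu : Covers N u
  · rw [extend_singleton_of_covers hu, free, ind_false (not_not.2 hu)]
    ring
  · rw [extend_singleton_of_not_covers hu fun h => hv (I.freshArrival_support a hl hN v h), free,
      ind_true hu, one_mul]

/-- The probability that `u` is unmatched after the vertices of `l` have arrived. -/
noncomputable def Input.freeProb (I : Input V) (a : V → List V → V → unitInterval) (l : List V)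
    (u : V) : ℝ := expect (I.freshArrival a l) fun N => free N u

/-- The probability that `u` and `w` are unmatched after the vertices of `l` have arrived. -/
noncomputable def Input.freeProb₂ (I : Input V) (a : V → List V → V → unitInterval) (l : List V)
    (u w : V) : ℝ := expect (I.freshArrival a l) fun N => free N u * free N w

section

variable (I : Input V) (a : V → List V → V → unitInterval) {v : V} {l : List V}

theorem Input.freeProb₂_self (u : V) : I.freeProb₂ a l u u = I.freeProb a l u := by
  simp only [Input.freeProb₂, free_mul_self, Input.freeProb]

theorem Input.freeProb₂_comm (u w : V) : I.freeProb₂ a l u w = I.freeProb₂ a l w u := by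
  simp only [Input.freeProb₂, mul_comm]

theorem Input.freeProb_nonneg (u : V) : 0 ≤ I.freeProb a l u :=
  expect_nonneg fun _ _ => ind_nonneg _

theorem Input.freeProb_le_one (u : V) : I.freeProb a l u ≤ 1 := by
  rw [← expect_const (I.freshArrival a l) 1]
  exact expect_mono fun _ _ => ind_le_one _

theorem Input.expect_mul_free_eq (hl : l.Nodup) (hv : v ∉ l) (φ : Finset (Sym2 V) → ℝ) :
    expect (I.freshArrival a l) (fun N => φ N * free N v) = expect (I.freshArrival a l) φ :=
  expect_congr fun N hN => by
    rw [free, ind_true fun h => hv (I.freshArrival_support a hl hN v h), mul_one]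

theorem Input.freeProb_of_notMem (hl : l.Nodup) (hv : v ∉ l) : I.freeProb a l v = 1 := by
  have := I.expect_mul_free_eq a hl hv fun _ => 1
  simpa only [one_mul, expect_const, Input.freeProb] using this

theorem Input.freeProb_cons_of_mem (hl : (v :: l).Nodup) {w : V} (hw : w ∈ l) :
    I.freeProb a (v :: l) w = I.freeProb a l w * (1 - I.proposeProb a v l w) := by
  have hwv : w ≠ v := fun h => (List.nodup_cons.1 hl).1 (h ▸ hw)
  rw [Input.freeProb, I.expect_freshArrival_cons a hl, Finset.sum_eq_single w]
  · have : ∀ N : Finset (Sym2 V), free N w * (free (insert s(w, v) N) w - free N w) =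
        -1 * free N w := fun N => by
      rw [free_insert, if_pos (.inl rfl)]
      linear_combination -free_mul_self N w
    simp only [this, expect_const_mul, Input.freeProb]
    ring
  · intro u _ hu
    have : ∀ N : Finset (Sym2 V), free N u * (free (insert s(u, v) N) w - free N w) = 0 :=
      fun N => by rw [free_insert, if_neg (not_or.2 ⟨hu.symm, hwv⟩), sub_self, mul_zero]
    simp only [this, expect_const, mul_zero]
  · exact fun h => absurd (List.mem_toFinset.2 hw) h

theorem Input.freeProb_cons_self (hl : (v :: l).Nodup) :
    I.freeProb a (v :: l) v =
      1 - ∑ u ∈ l.toFinset, I.proposeProb a v l u * I.freeProb a l u := by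
  obtain ⟨hv, hl'⟩ := List.nodup_cons.1 hl
  have h1 := I.freeProb_of_notMem a hl' hv
  rw [Input.freeProb] at h1
  rw [Input.freeProb, I.expect_freshArrival_cons a hl, h1, sub_eq_add_neg, ← Finset.sum_neg_distrib]
  congr 1
  refine Finset.sum_congr rfl fun u _ => ?_
  have : ∀ N : Finset (Sym2 V), free N u * (free (insert s(u, v) N) v - free N v) =
      -1 * (free N u * free N v) := fun N => by
    rw [free_insert, if_pos (.inr rfl)]
    ring
  simp only [this, expect_const_mul, I.expect_mul_free_eq a hl' hv, Input.freeProb]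
  ring

/-- Proposals of `v` to `w` and to `z` exclude each other, so the losses add instead of multiplying.
-/
theorem Input.freeProb₂_cons_of_mem (hl : (v :: l).Nodup) {w z : V} (hw : w ∈ l) (hz : z ∈ l)
    (hwz : w ≠ z) :
    I.freeProb₂ a (v :: l) w z =
      I.freeProb₂ a l w z * (1 - I.proposeProb a v l w - I.proposeProb a v l z) := by
  have hv := (List.nodup_cons.1 hl).1
  have hwv : w ≠ v := fun h => hv (h ▸ hw)
  have hzv : z ≠ v := fun h => hv (h ▸ hz)
  have key : ∀ (u : V) (N : Finset (Sym2 V)),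
      free N u * (free (insert s(u, v) N) w * free (insert s(u, v) N) z - free N w * free N z) =
        -((if u = w then 1 else 0) + (if u = z then 1 else 0)) * (free N w * free N z) := by
    intro u N
    rw [free_insert, free_insert]
    by_cases h1 : u = w
    · subst h1
      simp only [true_or, if_true, if_neg hwz]
      linear_combination -free N z * free_mul_self N u
    · by_cases h2 : u = z
      · subst h2
        simp only [true_or, if_true, if_neg h1]
        linear_combination -free N w * free_mul_self N u
      · simp only [if_neg h1, if_neg h2, if_neg (not_or.2 ⟨Ne.symm h1, hwv⟩),
          if_neg (not_or.2 ⟨Ne.symm h2, hzv⟩)]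
        ring
  rw [Input.freeProb₂, I.expect_freshArrival_cons a hl]
  simp only [key, expect_const_mul]
  simp only [neg_mul, mul_neg, add_mul, mul_add, ite_mul, mul_ite, one_mul, zero_mul, mul_zero,
    Finset.sum_neg_distrib, Finset.sum_add_distrib, Finset.sum_ite_eq', List.mem_toFinset, hw, hz,
    if_true, Input.freeProb₂]
  ring

theorem Input.freeProb₂_cons_self (hl : (v :: l).Nodup) (w : V) :
    I.freeProb₂ a (v :: l) w v = I.freeProb a l w -
      ∑ u ∈ l.toFinset, I.proposeProb a v l u * I.freeProb₂ a l w u := by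
  obtain ⟨hv, hl'⟩ := List.nodup_cons.1 hl
  rw [Input.freeProb₂, I.expect_freshArrival_cons a hl, I.expect_mul_free_eq a hl' hv,
    sub_eq_add_neg, ← Finset.sum_neg_distrib]
  congr 1
  refine Finset.sum_congr rfl fun u _ => ?_
  have : ∀ N : Finset (Sym2 V), free N u *
      (free (insert s(u, v) N) w * free (insert s(u, v) N) v - free N w * free N v) =
      -1 * (free N w * free N u * free N v) := fun N => by
    rw [free_insert (w := v), if_pos (.inr rfl)]
    ring
  simp only [this, expect_const_mul, I.expect_mul_free_eq a hl' hv, Input.freeProb₂]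
  ring

theorem Input.matchProb_cons_self (hl : (v :: l).Nodup) {u : V} (hu : u ∈ l) :
    expect (I.freshArrival a (v :: l)) (fun N => ind (s(u, v) ∈ N)) =
      I.proposeProb a v l u * I.freeProb a l u := by
  obtain ⟨hv, hl'⟩ := List.nodup_cons.1 hl
  have h0 : ∀ N ∈ (I.freshArrival a l).support, ind (s(u, v) ∈ N) = 0 := fun N hN =>
    ind_false fun h => hv (I.freshArrival_support a hl' hN v ⟨_, h, by simp⟩)
  rw [I.expect_freshArrival_cons a hl, expect_congr h0, expect_const, zero_add,
    Finset.sum_eq_single u]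
  · rw [Input.freeProb]
    congr 1
    refine expect_congr fun N hN => ?_
    rw [h0 N hN, ind_true (Finset.mem_insert_self _ _)]
    ring
  · intro w _ hw
    rw [expect_congr (Y := fun _ => 0), expect_const, mul_zero]
    intro N hN
    rw [ind_congr (Q := s(u, v) ∈ N), h0 N hN]
    · ring
    · rw [Finset.mem_insert, or_iff_right fun h => hw (Sym2.congr_left.1 h).symm]
  · exact fun h => absurd (List.mem_toFinset.2 hu) h

theorem Input.matchProb_cons_of_mem (hl : (v :: l).Nodup) {w z : V} (hw : w ∈ l) (hz : z ∈ l) :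
    expect (I.freshArrival a (v :: l)) (fun N => ind (s(w, z) ∈ N)) =
      expect (I.freshArrival a l) (fun N => ind (s(w, z) ∈ N)) := by
  have hv := (List.nodup_cons.1 hl).1
  rw [I.expect_freshArrival_cons a hl, Finset.sum_eq_zero, add_zero]
  intro u _
  rw [expect_congr (Y := fun _ => 0), expect_const, mul_zero]
  intro N _
  rw [ind_congr (Q := s(w, z) ∈ N), sub_self, mul_zero]
  rw [Finset.mem_insert, or_iff_right]
  intro h
  have : v ∈ s(w, z) := h ▸ Sym2.mem_mk_right u v
  rcases Sym2.mem_iff.1 this with rfl | rfl <;> exact hv (by assumption)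

/-- The covariance of the events that `u` and that `w` is unmatched after the arrival of the
vertices of `l`. -/
noncomputable def Input.freeCov (l : List V) (u w : V) : ℝ :=
  I.freeProb₂ a l u w - I.freeProb a l u * I.freeProb a l w

theorem Input.freeCov_comm (u w : V) : I.freeCov a l u w = I.freeCov a l w u := by
  rw [Input.freeCov, Input.freeCov, I.freeProb₂_comm, mul_comm]

/-- The new negative term is the difference between the pair factor 1 - Y_w - Y_z and the product (1
- Y_w)(1 - Y_z), with Y the proposal probabilities. -/
theorem Input.freeCov_cons_of_mem (hl : (v :: l).Nodup) {w z : V} (hw : w ∈ l) (hz : z ∈ l)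
    (hwz : w ≠ z) :
    I.freeCov a (v :: l) w z =
      I.freeCov a l w z * (1 - I.proposeProb a v l w - I.proposeProb a v l z) -
      I.freeProb a l w * I.freeProb a l z * (I.proposeProb a v l w * I.proposeProb a v l z) := by
  rw [Input.freeCov, Input.freeCov, I.freeProb₂_cons_of_mem a hl hw hz hwz,
    I.freeProb_cons_of_mem a hl hw, I.freeProb_cons_of_mem a hl hz]
  ring

/-- The newcomer inherits covariances through the vertices it may propose to. The term of `w` itself
is a variance and is split off; what remains of it is of the order of the proposal probability to
`w`. -/
theorem Input.freeCov_cons_self (hl : (v :: l).Nodup) {w : V} (hw : w ∈ l) :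
    I.freeCov a (v :: l) w v =
      -(∑ u ∈ l.toFinset.erase w, I.proposeProb a v l u * I.freeCov a l w u) +
      I.proposeProb a v l w * (I.freeProb a l w * (I.freeProb a l w *
        (1 - I.proposeProb a v l w) -
        ∑ u ∈ l.toFinset.erase w, I.proposeProb a v l u * I.freeProb a l u)) := by
  have hw' := List.mem_toFinset.2 hw
  rw [Input.freeCov, I.freeProb₂_cons_self a hl w, I.freeProb_cons_of_mem a hl hw,
    I.freeProb_cons_self a hl, ← Finset.add_sum_erase _ _ hw', ← Finset.add_sum_erase _ _ hw',
    I.freeProb₂_self]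
  have : ∀ u, I.proposeProb a v l u * I.freeProb₂ a l w u =
      I.proposeProb a v l u * I.freeCov a l w u +
      I.freeProb a l w * (I.proposeProb a v l u * I.freeProb a l u) := fun u => by
    rw [Input.freeCov]
    ring
  simp only [this, Finset.sum_add_distrib, ← Finset.mul_sum]
  ring

end

end Moments

/-! ### Bounds on the covariances -/

/-- One step of the potential argument that bounds sums of covariances. Here `c` and `c'` bound the
absolute values of the covariances before and after the arrival of `v`, `Y u` is the probability
that `v` proposes to `u`, and `r u` bounds the total probability of the future proposals to `u`. -/
theorem potential_step {ι : Type*} [DecidableEq ι] {S : Finset ι} {v : ι} (hv : v ∉ S)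
    {c c' : ι → ι → ℝ} {Y y r r' : ι → ℝ} {θ B : ℝ} (hθ : 0 < θ)
    (hc : ∀ u w, 0 ≤ c u w) (hcomm : ∀ u w, c u w = c w u) (hcomm' : ∀ u w, c' u w = c' w u)
    (h₁ : ∀ u ∈ S, ∀ w ∈ S, u ≠ w → c' u w ≤ c u w + Y u * Y w)
    (h₂ : ∀ u ∈ S, c' u v ≤ ∑ w ∈ S.erase u, Y w * c u w + Y u)
    (hY : ∀ u ∈ S, 0 ≤ Y u) (hYsum : ∑ u ∈ S, Y u ≤ 1 - θ) (hYy : ∀ u ∈ S, Y u ≤ y u)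
    (hr : ∀ u ∈ insert v S, r' u = r u - y u) (hr0 : ∀ u ∈ insert v S, 0 ≤ r' u)
    (hr1 : ∀ u ∈ insert v S, r' u ≤ 1 - θ) (hB : 3 * (1 + 1 / θ) ≤ θ * B)
    (ih : ∀ u ∈ S, ∑ w ∈ S.erase u, c u w * (1 + 1 / θ * r w) + 2 * (1 + 1 / θ) * r u ≤ B) :
    ∀ u ∈ insert v S, ∑ w ∈ (insert v S).erase u, c' u w * (1 + 1 / θ * r' w) +
      2 * (1 + 1 / θ) * r' u ≤ B := by
  set g := 1 / θ with hg
  have hg0 : 0 < g := one_div_pos.2 hθ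
  have hgθ : g * θ = 1 := one_div_mul_cancel hθ.ne'
  have hB0 : 0 ≤ B := by
    by_contra h
    nlinarith
  have hf0 : ∀ u ∈ insert v S, 0 ≤ 1 + g * r' u := fun u hu => by
    nlinarith [hr0 u hu]
  -- Since `r'` is at most 1 - θ, the weight is at most 1 + (1 - θ)/θ = `g`. This is why the slope
  -- of the potential is 1/θ.
  have hfg : ∀ u ∈ insert v S, 1 + g * r' u ≤ g := fun u hu => by
    nlinarith [hr1 u hu, mul_le_mul_of_nonneg_left (hr1 u hu) hg0.le]
  have hfr : ∀ w ∈ S, 1 + g * r' w ≤ 1 + g * r w - g * Y w := fun w hw => by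
    have := mul_le_mul_of_nonneg_left (hYy w hw) hg0.le
    rw [hr w (Finset.mem_insert_of_mem hw)]
    linarith
  have hsub : ∀ u ∈ S, ∑ w ∈ S.erase u, Y w ≤ 1 - θ := fun u _ =>
    (Finset.sum_le_sum_of_subset_of_nonneg (Finset.erase_subset _ _) fun w hw _ => hY w hw).trans
      hYsum
  intro u hu
  rcases Finset.mem_insert.1 hu with rfl | huS
  -- The arriving vertex: exchanging sums bounds its row by a combination of old rows with total
  -- weight at most 1 - θ. Hence its potential is at most (1 - θ)B + 3(1 + g), which `hB` makes at
  -- most B.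
  · rw [Finset.erase_insert hv]
    have h3 : ∑ w ∈ S, c' u w * (1 + g * r' w) ≤
        ∑ w ∈ S, (∑ z ∈ S.erase w, Y z * c w z * (1 + g * r w) + Y w * g) := by
      refine Finset.sum_le_sum fun w hw => ?_
      have hw' : w ∈ insert u S := Finset.mem_insert_of_mem hw
      calc c' u w * (1 + g * r' w)
          ≤ (∑ z ∈ S.erase w, Y z * c w z + Y w) * (1 + g * r' w) := by
            rw [hcomm']
            exact mul_le_mul_of_nonneg_right (h₂ w hw) (hf0 w hw')
        _ = (∑ z ∈ S.erase w, Y z * c w z) * (1 + g * r' w) + Y w * (1 + g * r' w) := by ring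
        _ ≤ (∑ z ∈ S.erase w, Y z * c w z) * (1 + g * r w) + Y w * g := by
            refine add_le_add (mul_le_mul_of_nonneg_left ?_ ?_)
              (mul_le_mul_of_nonneg_left (hfg w hw') (hY w hw))
            · nlinarith [hfr w hw, mul_nonneg hg0.le (hY w hw)]
            · exact Finset.sum_nonneg fun z hz =>
                mul_nonneg (hY z (Finset.mem_of_mem_erase hz)) (hc _ _)
        _ = _ := by rw [Finset.sum_mul]
    have h4 : ∑ w ∈ S, ∑ z ∈ S.erase w, Y z * c w z * (1 + g * r w) =
        ∑ z ∈ S, Y z * ∑ w ∈ S.erase z, c z w * (1 + g * r w) := by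
      rw [Finset.sum_comm' (t' := S) (s' := fun z => S.erase z)
        (h := fun w z => by
          simp only [Finset.mem_erase]
          exact ⟨fun ⟨h1, h2, h3⟩ => ⟨⟨h2.symm, h1⟩, h3⟩, fun ⟨⟨h1, h2⟩, h3⟩ => ⟨h2, h1.symm, h3⟩⟩)]
      refine Finset.sum_congr rfl fun z _ => ?_
      rw [Finset.mul_sum]
      refine Finset.sum_congr rfl fun w _ => ?_
      rw [hcomm w z]
      ring
    have h5 : ∑ z ∈ S, Y z * ∑ w ∈ S.erase z, c z w * (1 + g * r w) ≤ ∑ z ∈ S, Y z * B := by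
      refine Finset.sum_le_sum fun z hz => mul_le_mul_of_nonneg_left ?_ (hY z hz)
      have h6 := ih z hz
      have h7 : 0 ≤ r z := by
        have hz' : z ∈ insert u S := Finset.mem_insert_of_mem hz
        linarith [hr z hz', hr0 z hz', hY z hz, hYy z hz]
      nlinarith [mul_nonneg hg0.le h7]
    rw [Finset.sum_add_distrib, h4, ← Finset.sum_mul] at h3
    rw [← Finset.sum_mul] at h5
    have h8 := hr1 u (Finset.mem_insert_self _ _)
    have h9 := mul_le_mul_of_nonneg_right hYsum hB0
    have h10 := mul_le_mul_of_nonneg_right hYsum hg0.le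
    nlinarith
  -- An earlier vertex: the new pair costs at most g(Q + Y u). The drop of the weights of the other
  -- vertices pays for gQ. What is left, including the increments of the old pairs, is at most 2g(Y
  -- u), paid for by the drop of `r u` in the last summand.
  · have huv : u ≠ v := fun h => hv (h ▸ huS)
    rw [Finset.erase_insert_of_ne huv.symm, Finset.sum_insert fun h => hv (Finset.mem_of_mem_erase h)]
    have hvS := Finset.mem_insert_self v S
    set Q := ∑ w ∈ S.erase u, Y w * c u w with hQ
    have hQ0 : 0 ≤ Q := Finset.sum_nonneg fun z hz =>
      mul_nonneg (hY z (Finset.mem_of_mem_erase hz)) (hc _ _)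
    have h3 : c' u v * (1 + g * r' v) ≤ (Q + Y u) * g :=
      (mul_le_mul_of_nonneg_right (h₂ u huS) (hf0 v hvS)).trans
        (mul_le_mul_of_nonneg_left (hfg v hvS) (add_nonneg hQ0 (hY u huS)))
    have h4 : ∑ w ∈ S.erase u, c' u w * (1 + g * r' w) ≤
        ∑ w ∈ S.erase u, (c u w * (1 + g * r w) - g * (Y w * c u w) + Y u * g * Y w) := by
      refine Finset.sum_le_sum fun w hw => ?_
      obtain ⟨hwu, hwS⟩ := Finset.mem_erase.1 hw
      have hw' : w ∈ insert v S := Finset.mem_insert_of_mem hwS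
      calc c' u w * (1 + g * r' w) ≤ (c u w + Y u * Y w) * (1 + g * r' w) :=
            mul_le_mul_of_nonneg_right (h₁ u huS w hwS hwu.symm) (hf0 w hw')
        _ = c u w * (1 + g * r' w) + Y u * Y w * (1 + g * r' w) := by ring
        _ ≤ c u w * (1 + g * r w - g * Y w) + Y u * Y w * g :=
            add_le_add (mul_le_mul_of_nonneg_left (hfr w hwS) (hc _ _))
              (mul_le_mul_of_nonneg_left (hfg w hw') (mul_nonneg (hY u huS) (hY w hwS)))
        _ = _ := by ring
    rw [Finset.sum_add_distrib, Finset.sum_sub_distrib, ← Finset.mul_sum, ← Finset.mul_sum, ← hQ]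
      at h4
    have h5 : Y u * g * ∑ w ∈ S.erase u, Y w ≤ Y u * g :=
      mul_le_of_le_one_right (mul_nonneg (hY u huS) hg0.le) ((hsub u huS).trans (by linarith))
    have h6 := ih u huS
    have h7 := hr u (Finset.mem_insert_of_mem huS)
    have h8 : Y u * g ≤ y u * g := mul_le_mul_of_nonneg_right (hYy u huS) hg0.le
    have h9 := hYy u huS
    have h10 := hY u huS
    rw [h7]
    nlinarith

section Covariance

open Classical

variable {V : Type u} [Fintype V]

/-- The bound does not depend on the graph: with acceptance at most 1 - θ, each vertex sends and
receives proposals of total probability at most 1 - θ, which keeps the propagation of covariances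
subcritical. -/
theorem Input.sum_abs_freeCov_le (I : Input V) (a : V → List V → V → unitInterval) {θ : ℝ}
    (hθ : 0 < θ) (hθ' : θ ≤ 1) {l : List V} (hl : l.Nodup)
    (ha : ∀ v l', v :: l' <:+ l → ∀ u ∈ l', (a v l' u : ℝ) ≤ 1 - θ) {u : V} (hu : u ∈ l) :
    ∑ w ∈ l.toFinset.erase u, |I.freeCov a l u w| ≤ 3 * (1 + 1 / θ) / θ := by
  -- The sum runs over the vertices yet to arrive.
  set r : List V → V → ℝ := fun l u => ∑ v ∈ Finset.univ \ l.toFinset, (1 - θ) * I.edgeProb u v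
    with hr
  have hy0 : ∀ u v, 0 ≤ (1 - θ) * I.edgeProb u v := fun u v =>
    mul_nonneg (by linarith) (I.edgeProb_nonneg u v)
  have hr0 : ∀ l u, 0 ≤ r l u := fun l u => Finset.sum_nonneg fun v _ => hy0 u v
  have hr1 : ∀ l u, r l u ≤ 1 - θ := fun l u =>
    calc r l u ≤ ∑ v, (1 - θ) * I.edgeProb u v :=
          Finset.sum_le_sum_of_subset_of_nonneg (Finset.subset_univ _) fun v _ _ => hy0 u v
      _ = (1 - θ) * ∑ v, I.edgeProb u v := by rw [Finset.mul_sum]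
      _ ≤ (1 - θ) * 1 := mul_le_mul_of_nonneg_left (I.sum_edgeProb_le_one u) (by linarith)
      _ = 1 - θ := mul_one _
  have main : ∀ u ∈ l.toFinset, ∑ w ∈ l.toFinset.erase u,
      |I.freeCov a l u w| * (1 + 1 / θ * r l w) + 2 * (1 + 1 / θ) * r l u ≤
        3 * (1 + 1 / θ) / θ := by
    clear hu
    induction l with
    | nil => simp
    | cons v l ih =>
      have hvl := (List.nodup_cons.1 hl).1
      rw [List.toFinset_cons]
      have ha' : ∀ u ∈ l, (a v l u : ℝ) ≤ 1 - θ := ha v l List.suffix_rfl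
      have hY0 : ∀ u, 0 ≤ I.proposeProb a v l u := fun u =>
        mul_nonneg (I.edgeProb_nonneg u v) (a v l u).2.1
      have hYy : ∀ u ∈ l.toFinset, I.proposeProb a v l u ≤ (1 - θ) * I.edgeProb u v :=
        fun u hu => by
          rw [Input.proposeProb, mul_comm]
          exact mul_le_mul_of_nonneg_right (ha' u (List.mem_toFinset.1 hu)) (I.edgeProb_nonneg u v)
      have hYsum : ∑ u ∈ l.toFinset, I.proposeProb a v l u ≤ 1 - θ := by
        calc _ ≤ ∑ u ∈ l.toFinset, (1 - θ) * I.edgeProb u v := Finset.sum_le_sum hYy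
          _ ≤ ∑ u, (1 - θ) * I.edgeProb u v :=
            Finset.sum_le_sum_of_subset_of_nonneg (Finset.subset_univ _) fun u _ _ => hy0 u v
          _ = (1 - θ) * ∑ u, I.edgeProb v u := by
            rw [Finset.mul_sum]
            simp only [I.edgeProb_comm v]
          _ ≤ (1 - θ) * 1 := mul_le_mul_of_nonneg_left (I.sum_edgeProb_le_one v) (by linarith)
          _ = 1 - θ := mul_one _
      refine potential_step (c := fun u w => |I.freeCov a l u w|)
        (Y := I.proposeProb a v l) (y := fun u => (1 - θ) * I.edgeProb u v) (r := r l)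
        (fun h => hvl (List.mem_toFinset.1 h)) hθ (fun _ _ => abs_nonneg _)
        (fun u w => by rw [I.freeCov_comm]) (fun u w => by rw [I.freeCov_comm]) ?_ ?_
        (fun u _ => hY0 u) hYsum hYy ?_ (fun u _ => hr0 _ u) (fun u _ => hr1 _ u)
        (le_of_eq (mul_div_cancel₀ _ hθ.ne').symm)
        (ih (List.nodup_cons.1 hl).2 fun v' l' h => ha v' l' (h.trans (List.suffix_cons v l)))
      · intro u hu w hw huw
        rw [I.freeCov_cons_of_mem a hl (List.mem_toFinset.1 hu) (List.mem_toFinset.1 hw) huw]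
        have h1 : I.proposeProb a v l u + I.proposeProb a v l w ≤ 1 := by
          rw [← Finset.sum_pair huw]
          refine (Finset.sum_le_sum_of_subset_of_nonneg ?_ fun z _ _ => hY0 z).trans
            (hYsum.trans (by linarith))
          exact Finset.insert_subset hu (Finset.singleton_subset_iff.2 hw)
        refine (abs_sub _ _).trans (add_le_add ?_ ?_)
        · rw [abs_mul]
          refine mul_le_of_le_one_right (abs_nonneg _) (abs_le.2 ⟨?_, ?_⟩) <;>
            linarith [hY0 u, hY0 w]
        · have h2 := mul_nonneg (hY0 u) (hY0 w)
          have h3 := mul_nonneg (I.freeProb_nonneg a (l := l) u) (I.freeProb_nonneg a (l := l) w)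
          rw [abs_of_nonneg (mul_nonneg h3 h2)]
          exact mul_le_of_le_one_left h2 (mul_le_one₀ (I.freeProb_le_one a u)
            (I.freeProb_nonneg a w) (I.freeProb_le_one a w))
      · intro u hu
        rw [I.freeCov_cons_self a hl (List.mem_toFinset.1 hu)]
        refine (abs_add_le _ _).trans (add_le_add ?_ ?_)
        · rw [abs_neg]
          refine (Finset.abs_sum_le_sum_abs _ _).trans (le_of_eq ?_)
          refine Finset.sum_congr rfl fun w _ => ?_
          rw [abs_mul, abs_of_nonneg (hY0 w)]
        · rw [abs_mul, abs_of_nonneg (hY0 u)]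
          refine mul_le_of_le_one_right (hY0 u) ?_
          have m0 := fun z => I.freeProb_nonneg a (l := l) z
          have m1 := fun z => I.freeProb_le_one a (l := l) z
          rw [abs_mul, abs_of_nonneg (m0 u)]
          have hs0 : 0 ≤ ∑ w ∈ l.toFinset.erase u, I.proposeProb a v l w * I.freeProb a l w :=
            Finset.sum_nonneg fun w _ => mul_nonneg (hY0 w) (m0 w)
          have hs1 : ∑ w ∈ l.toFinset.erase u, I.proposeProb a v l w * I.freeProb a l w +
              I.proposeProb a v l u ≤ 1 := by
            have : ∑ w ∈ l.toFinset.erase u, I.proposeProb a v l w * I.freeProb a l w ≤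
                ∑ w ∈ l.toFinset.erase u, I.proposeProb a v l w :=
              Finset.sum_le_sum fun w _ => mul_le_of_le_one_right (hY0 w) (m1 w)
            have h2 := Finset.sum_erase_add _ (I.proposeProb a v l) hu
            linarith
          refine mul_le_one₀ (m1 u) (abs_nonneg _) (abs_le.2 ⟨?_, ?_⟩)
          · have : 0 ≤ I.freeProb a l u * (1 - I.proposeProb a v l u) :=
              mul_nonneg (m0 u) (by linarith)
            linarith [hY0 u]
          · have : I.freeProb a l u * (1 - I.proposeProb a v l u) ≤ 1 :=
              mul_le_one₀ (m1 u) (by linarith) (by linarith [hY0 u])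
            linarith
      · intro u hu
        have hvm : v ∈ Finset.univ \ l.toFinset := by simp [hvl]
        have : Finset.univ \ (v :: l).toFinset = (Finset.univ \ l.toFinset).erase v := by
          rw [List.toFinset_cons, Finset.sdiff_insert]
        simp only [hr]
        rw [this, ← Finset.sum_erase_add _ _ hvm]
        ring
  have h1 := main u (List.mem_toFinset.2 hu)
  have hg0 : 0 < 1 / θ := one_div_pos.2 hθ
  have h2 : ∑ w ∈ l.toFinset.erase u, |I.freeCov a l u w| ≤ ∑ w ∈ l.toFinset.erase u,
      |I.freeCov a l u w| * (1 + 1 / θ * r l w) := by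
    refine Finset.sum_le_sum fun w _ => le_mul_of_one_le_right (abs_nonneg _) ?_
    have := mul_nonneg hg0.le (hr0 l w)
    linarith
  have h3 := mul_nonneg (by positivity : 0 ≤ 2 * (1 + 1 / θ)) (hr0 l u)
  linarith

end Covariance

/-! ### Mechanisms with prescribed marginals -/

section Mechanism

open Classical

instance {V : Type u} [Finite V] : Finite (Output V) :=
  Finite.of_injective (fun o : Output V => (o.Mc, o.A)) fun o o' h => by
    cases o; cases o'; simpa using h

variable {V : Type u} [Fintype V]

/-- The randomized procedure `κ` returns a matching of the realized graph that contains each edge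
`s(u, v)` with probability `β u v`, and a set of unmatched vertices that contains each `v` with
probability `p v`, where the absolute values of the covariances of the membership of a vertex with
the others add up to at most `B`. -/
structure Input.IsMechanism (I : Input V) (κ : Finset (Sym2 V) → PMF (Output V)) (β : V → V → ℝ)
    (p : V → ℝ) (B : ℝ) : Prop where
  valid : ∀ R, R ⊆ edges I.H → ∀ o ∈ (κ R).support,
    IsMatchingOf R o.Mc ∧ ∀ v ∈ o.A, ¬ Covers o.Mc v
  edge : ∀ u v, u ≠ v →
    expect ((realizationLaw I.H I.p).bind κ) (fun o => ind (s(u, v) ∈ o.Mc)) = β u v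
  mem : ∀ v, expect ((realizationLaw I.H I.p).bind κ) (fun o => ind (v ∈ o.A)) = p v
  cov : ∀ u, ∑ w ∈ Finset.univ.erase u,
    |expect ((realizationLaw I.H I.p).bind κ) (fun o => ind (u ∈ o.A) * ind (w ∈ o.A)) -
      p u * p w| ≤ B

/-- Expand the square: a row of the covariance matrix has absolute sum at most 1 + B, the 1 being
for the diagonal. The centre depends on `p` alone, so the bounds of mechanisms with equal marginals
can be averaged. -/
theorem expect_sq_sum_le {α ι : Type*} [Finite α] [Fintype ι] (μ : PMF α) (P : ι → α → Prop)
    {p : ι → ℝ} {B : ℝ} (hmem : ∀ i, expect μ (fun o => ind (P i o)) = p i)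
    (hcov : ∀ i, ∑ j ∈ Finset.univ.erase i,
      |expect μ (fun o => ind (P i o) * ind (P j o)) - p i * p j| ≤ B)
    (S : Finset ι) {c : ι → ℝ} {m : ℝ} (hc : ∀ i ∈ S, 0 ≤ c i) (hm : ∀ i ∈ S, c i ≤ m) :
    expect μ (fun o => (∑ i ∈ S, c i * ind (P i o) - ∑ i ∈ S, c i * p i) ^ 2) ≤
      m * (∑ i ∈ S, c i) * (1 + B) := by
  set C : ι → ι → ℝ := fun i j => expect μ (fun o => ind (P i o) * ind (P j o)) - p i * p j with hC
  have h1 : ∀ i j, expect μ (fun o => (ind (P i o) - p i) * (ind (P j o) - p j)) = C i j := by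
    intro i j
    have : (fun o => (ind (P i o) - p i) * (ind (P j o) - p j)) = fun o =>
        ind (P i o) * ind (P j o) - (p j * ind (P i o) + (p i * ind (P j o) - p i * p j)) := by
      funext o; ring
    rw [this, expect_sub, expect_add, expect_sub, expect_const_mul, expect_const_mul, expect_const,
      hmem, hmem]
    simp only [hC]
    ring
  have h2 : expect μ (fun o => (∑ i ∈ S, c i * ind (P i o) - ∑ i ∈ S, c i * p i) ^ 2) =
      ∑ i ∈ S, ∑ j ∈ S, c i * c j * C i j := by
    simp only [← h1, ← expect_const_mul, ← expect_sum]
    congr 1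
    funext o
    rw [← Finset.sum_sub_distrib, sq, Finset.sum_mul_sum]
    refine Finset.sum_congr rfl fun i _ => Finset.sum_congr rfl fun j _ => ?_
    ring
  have h3 : ∀ i, ∑ j, |C i j| ≤ 1 + B := by
    intro i
    rw [← Finset.add_sum_erase _ _ (Finset.mem_univ i)]
    refine add_le_add ?_ (hcov i)
    have hp : 0 ≤ p i ∧ p i ≤ 1 := by
      rw [← hmem, ← prob_eq_expect]
      exact ⟨prob_nonneg _ _, prob_le_one _ _⟩
    simp only [hC, ind_mul_self, hmem]
    rw [abs_le]
    constructor <;> nlinarith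
  rw [h2, Finset.mul_sum, Finset.sum_mul]
  refine Finset.sum_le_sum fun i hi => ?_
  have hm0 : 0 ≤ m := (hc i hi).trans (hm i hi)
  calc ∑ j ∈ S, c i * c j * C i j ≤ ∑ j ∈ S, m * c i * |C i j| := by
        refine Finset.sum_le_sum fun j hj => ?_
        calc c i * c j * C i j ≤ c i * c j * |C i j| :=
              mul_le_mul_of_nonneg_left (le_abs_self _) (mul_nonneg (hc i hi) (hc j hj))
          _ ≤ m * c i * |C i j| := by
              refine mul_le_mul_of_nonneg_right ?_ (abs_nonneg _)
              rw [mul_comm]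
              exact mul_le_mul_of_nonneg_right (hm j hj) (hc i hi)
    _ = m * c i * ∑ j ∈ S, |C i j| := by rw [Finset.mul_sum]
    _ ≤ m * c i * (1 + B) := by
        refine mul_le_mul_of_nonneg_left ?_ (mul_nonneg hm0 (hc i hi))
        exact (Finset.sum_le_sum_of_subset_of_nonneg (Finset.subset_univ _)
          fun _ _ _ => abs_nonneg _).trans (h3 i)

/-- Draw a matching of the realized graph with `MO`, draw `A` independently with marginals `p`, and
drop the edges that meet `A`. -/
noncomputable def Input.thin (I : Input V) (p : V → unitInterval) (R : Finset (Sym2 V)) :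
    PMF (Output V) :=
  (I.MO R).bind fun M => (bernoulliSubset p Finset.univ).bind fun B =>
    PMF.pure ⟨M.filter fun e => ∀ v ∈ e, v ∉ B, B⟩

theorem Input.bind_thin (I : Input V) (p : V → unitInterval) :
    (realizationLaw I.H I.p).bind (I.thin p) =
      I.lawMO.bind fun M => (bernoulliSubset p Finset.univ).bind fun B =>
        PMF.pure ⟨M.filter fun e => ∀ v ∈ e, v ∉ B, B⟩ := by
  rw [Input.lawMO, PMF.bind_bind]
  rfl

theorem Input.expect_thin_mem_mul_mem (I : Input V) (p : V → unitInterval) {u v : V} (h : u ≠ v) :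
    expect ((realizationLaw I.H I.p).bind (I.thin p)) (fun o => ind (u ∈ o.A) * ind (v ∈ o.A)) =
      p u * p v := by
  simp only [I.bind_thin, expect_bind, expect_pure, expect_const,
    expect_ind_mem_mul_bernoulliSubset p (Finset.mem_univ u) (Finset.mem_univ v) h]

theorem Input.isMechanism_thin (I : Input V) (p : V → unitInterval) :
    I.IsMechanism (I.thin p) (fun u v => I.edgeProb u v * ((1 - p u) * (1 - p v)))
      (fun v => p v) 0 where
  valid R hR o ho := by
    simp only [Input.thin, PMF.mem_support_bind_iff, PMF.mem_support_pure_iff] at ho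
    obtain ⟨M, hM, B, -, rfl⟩ := ho
    have h := I.isMatching R hR M hM
    refine ⟨⟨(Finset.filter_subset _ _).trans h.1, fun e he e' he' =>
      h.2 e (Finset.mem_filter.1 he).1 e' (Finset.mem_filter.1 he').1⟩, ?_⟩
    rintro v hv ⟨e, he, hve⟩
    exact (Finset.mem_filter.1 he).2 v hve hv
  edge u v huv := by
    have h1 : ∀ (M : Finset (Sym2 V)) (B : Finset V),
        ind (s(u, v) ∈ M.filter fun e => ∀ v ∈ e, v ∉ B) =
          ind (s(u, v) ∈ M) *
            (1 - ind (u ∈ B) - (ind (v ∈ B) - ind (u ∈ B) * ind (v ∈ B))) := by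
      intro M B
      have : s(u, v) ∈ (M.filter fun e => ∀ v ∈ e, v ∉ B) ↔
          s(u, v) ∈ M ∧ u ∉ B ∧ v ∉ B := by
        simp [Finset.mem_filter]
      rw [ind_congr this, ind_and, ind_and, ind_not, ind_not]
      ring
    simp only [I.bind_thin, expect_bind, expect_pure, h1, expect_const_mul, expect_sub,
      expect_const, expect_ind_mem_mul_bernoulliSubset p (Finset.mem_univ u) (Finset.mem_univ v)
      huv, expect_ind_mem_bernoulliSubset p (Finset.mem_univ _), expect_mul_const, Input.edgeProb,
      prob_eq_expect]
    ring
  mem v := by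
    simp only [I.bind_thin, expect_bind, expect_pure, expect_const,
      expect_ind_mem_bernoulliSubset p (Finset.mem_univ v)]
  cov u := by
    refine le_of_eq (Finset.sum_eq_zero fun w hw => ?_)
    rw [I.expect_thin_mem_mul_mem p (Finset.ne_of_mem_erase hw).symm, sub_self, abs_zero]

/-- The conditional acceptance probability of an edge that should be matched with probability `α`
times its probability of being proposed. -/
noncomputable def Input.acceptance (I : Input V) (α : V → V → ℝ) (v : V) (l : List V) (u : V) :
    unitInterval :=
  Set.projIcc 0 1 zero_le_one (α u v / (1 - ∑ w ∈ l.toFinset, α u w * I.edgeProb u w))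

/-- The target `α` can be reached when the vertices of `L` arrive one by one, the head being the
last to arrive. -/
def Input.Feasible (I : Input V) (θ : ℝ) (α : V → V → ℝ) (L : List V) : Prop :=
  ∀ v l, v :: l <:+ L → ∀ u ∈ l,
    α u v ≤ (1 - θ) * (1 - ∑ w ∈ l.toFinset, α u w * I.edgeProb u w)

section

variable {I : Input V} {θ : ℝ} {α : V → V → ℝ} {L : List V}

theorem Input.Feasible.of_cons {v : V} (h : I.Feasible θ α (v :: L)) : I.Feasible θ α L :=
  fun w l hl => h w l (hl.trans (List.suffix_cons v L))

theorem Input.acceptance_eq (hθ : 0 ≤ θ) (hθ' : θ < 1) (hα : ∀ u v, 0 ≤ α u v)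
    (hL : I.Feasible θ α L) {v : V} {l : List V} (hl : v :: l <:+ L) {u : V} (hu : u ∈ l) :
    I.acceptance α v l u * (1 - ∑ w ∈ l.toFinset, α u w * I.edgeProb u w) = α u v ∧
      (I.acceptance α v l u : ℝ) ≤ 1 - θ := by
  have h1 := hL v l hl u hu
  set D := 1 - ∑ w ∈ l.toFinset, α u w * I.edgeProb u w with hD
  have hD0 : 0 ≤ D := by
    have h2 := (hα u v).trans h1
    by_contra h
    nlinarith
  have h2 : α u v / D ≤ 1 - θ := div_le_of_le_mul₀ hD0 (by linarith) h1
  have h3 : (I.acceptance α v l u : ℝ) = α u v / D := by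
    rw [Input.acceptance, ← hD,
      Set.projIcc_of_mem _ (⟨div_nonneg (hα u v) hD0, by linarith⟩ : α u v / D ∈ Set.Icc (0 : ℝ) 1)]
  refine ⟨?_, h3 ▸ h2⟩
  rw [h3]
  -- If the denominator vanishes, feasibility forces α u v = 0, so the junk value of the division is
  -- harmless.
  rcases hD0.eq_or_lt with h | h
  · rw [← h] at h1 ⊢
    rw [mul_zero] at h1 ⊢
    exact (hα u v).antisymm h1
  · exact div_mul_cancel₀ _ h.ne'

/-- The denominator in `acceptance` is, inductively, the probability that `u` is still free. It
cancels, so each arrival `w` uses up exactly α u w times the edge probability. -/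
theorem Input.freeProb_acceptance (hθ : 0 ≤ θ) (hθ' : θ < 1) (hα : ∀ u v, 0 ≤ α u v)
    (hαc : ∀ u v, α u v = α v u) (hnd : L.Nodup) (hL : I.Feasible θ α L) {u : V} (hu : u ∈ L) :
    I.freeProb (I.acceptance α) L u = 1 - ∑ w ∈ L.toFinset, α u w * I.edgeProb u w := by
  induction L generalizing u with
  | nil => simp at hu
  | cons v l ih =>
    have hv := (List.nodup_cons.1 hnd).1
    have hv' : v ∉ l.toFinset := fun h => hv (List.mem_toFinset.1 h)
    have ih := fun {u} (hu : u ∈ l) => ih (List.nodup_cons.1 hnd).2 hL.of_cons hu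
    have hacc := fun {u} (hu : u ∈ l) =>
      (Input.acceptance_eq hθ hθ' hα hL List.suffix_rfl hu).1
    rw [List.toFinset_cons, Finset.sum_insert hv']
    rcases List.mem_cons.1 hu with rfl | hul
    · rw [I.freeProb_cons_self _ hnd, I.edgeProb_self, mul_zero, zero_add]
      congr 1
      refine Finset.sum_congr rfl fun w hw => ?_
      have hw := List.mem_toFinset.1 hw
      rw [ih hw, Input.proposeProb, mul_assoc, hacc hw, hαc w, I.edgeProb_comm, mul_comm]
    · rw [I.freeProb_cons_of_mem _ hnd hul, ih hul, Input.proposeProb]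
      linear_combination (-I.edgeProb u v) * hacc hul

theorem Input.matchProb_acceptance (hθ : 0 ≤ θ) (hθ' : θ < 1) (hα : ∀ u v, 0 ≤ α u v)
    (hαc : ∀ u v, α u v = α v u) (hnd : L.Nodup) (hL : I.Feasible θ α L) {u v : V} (hu : u ∈ L)
    (hv : v ∈ L) (huv : u ≠ v) :
    expect (I.freshArrival (I.acceptance α) L) (fun N => ind (s(u, v) ∈ N)) =
      α u v * I.edgeProb u v := by
  induction L generalizing u v with
  | nil => simp at hu
  | cons z l ih =>
    have key : ∀ u ∈ l, expect (I.freshArrival (I.acceptance α) (z :: l))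
        (fun N => ind (s(u, z) ∈ N)) = α u z * I.edgeProb u z := by
      intro u hu
      rw [I.matchProb_cons_self _ hnd hu, Input.freeProb_acceptance hθ hθ' hα hαc
        (List.nodup_cons.1 hnd).2 hL.of_cons hu, Input.proposeProb, mul_assoc,
        (Input.acceptance_eq hθ hθ' hα hL List.suffix_rfl hu).1, mul_comm]
    rcases List.mem_cons.1 hu with hu' | hu' <;> rcases List.mem_cons.1 hv with hv' | hv'
    · exact absurd (hu'.trans hv'.symm) huv
    · rw [hu', Sym2.eq_swap, key v hv', hαc, I.edgeProb_comm]
    · rw [hv', key u hu']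
    · rw [I.matchProb_cons_of_mem _ hnd hu' hv']
      exact ih (List.nodup_cons.1 hnd).2 hL.of_cons hu' hv' huv

end

/-- Run the arrival procedure and let `A` contain each unmatched `v` independently with probability
`q v`. -/
noncomputable def Input.contention (I : Input V) (a : V → List V → V → unitInterval) (L : List V)
    (q : V → unitInterval) (R : Finset (Sym2 V)) : PMF (Output V) :=
  (I.arrival a R L).bind fun N => (bernoulliSubset q Finset.univ).bind fun B =>
    PMF.pure ⟨N, B.filter fun v => ¬ Covers N v⟩

theorem Input.bind_contention (I : Input V) (a : V → List V → V → unitInterval) {L : List V}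
    (hL : L.Nodup) (q : V → unitInterval) :
    (realizationLaw I.H I.p).bind (I.contention a L q) =
      (I.freshArrival a L).bind fun N => (bernoulliSubset q Finset.univ).bind fun B =>
        PMF.pure ⟨N, B.filter fun v => ¬ Covers N v⟩ := by
  rw [← I.bind_arrival a hL (Finset.filter_subset _ _ : _ ⊆ edges I.H), PMF.bind_bind,
    realizationLaw_eq]
  rfl

theorem Input.exists_isMechanism_of_feasible (I : Input V) {θ : ℝ} (hθ : 0 < θ) (hθ' : θ < 1)
    {α : V → V → ℝ} (hα : ∀ u v, 0 ≤ α u v) (hαc : ∀ u v, α u v = α v u)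
    (hα1 : ∀ u v, u ≠ v → α u v ≤ 1 - θ) {L : List V} (hnd : L.Nodup) (hmem : ∀ v, v ∈ L)
    (hL : I.Feasible θ α L) :
    ∃ κ, I.IsMechanism κ (fun u v => α u v * I.edgeProb u v)
      (fun v => 1 - (1 - θ) * ∑ u, I.edgeProb v u) (3 * (1 + 1 / θ) / θ) := by
  set p : V → ℝ := fun v => 1 - (1 - θ) * ∑ u, I.edgeProb v u with hp
  set a := I.acceptance α with ha
  have huniv : L.toFinset = Finset.univ := by
    ext v
    simp [hmem v]
  have hp0 : ∀ v, 0 < p v := fun v => by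
    have := I.sum_edgeProb_le_one v
    simp only [hp]
    nlinarith
  have hf : ∀ v, p v ≤ I.freeProb a L v := by
    intro v
    rw [Input.freeProb_acceptance hθ.le hθ' hα hαc hnd hL (hmem v), huniv, hp]
    refine sub_le_sub_left ?_ 1
    rw [Finset.mul_sum]
    refine Finset.sum_le_sum fun u _ => ?_
    by_cases h : v = u
    · rw [h, I.edgeProb_self, mul_zero, mul_zero]
    · exact mul_le_mul_of_nonneg_right (hα1 v u h) (I.edgeProb_nonneg v u)
  -- Thinning the free vertices by this ratio gives the marginals `p`, which do not depend on α or
  -- on the order.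
  set q : V → unitInterval := fun v => ⟨p v / I.freeProb a L v,
    div_nonneg (hp0 v).le (I.freeProb_nonneg a v),
    div_le_one_of_le₀ (hf v) (I.freeProb_nonneg a v)⟩ with hq
  have hqf : ∀ v, (q v : ℝ) * I.freeProb a L v = p v := fun v =>
    div_mul_cancel₀ _ ((hp0 v).trans_le (hf v)).ne'
  have hind : ∀ (N : Finset (Sym2 V)) (B : Finset V) v,
      ind (v ∈ B.filter fun v => ¬ Covers N v) = free N v * ind (v ∈ B) := by
    intro N B v
    rw [ind_congr (Finset.mem_filter (p := fun v => ¬ Covers N v)), ind_and, free, mul_comm]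
  refine ⟨I.contention a L q, ?_, ?_, ?_, ?_⟩
  · intro R _ o ho
    simp only [Input.contention, PMF.mem_support_bind_iff, PMF.mem_support_pure_iff] at ho
    obtain ⟨N, hN, B, -, rfl⟩ := ho
    exact ⟨(I.arrival_support a R hnd hN).1, fun v hv => (Finset.mem_filter.1 hv).2⟩
  · intro u v huv
    simp only [I.bind_contention a hnd, expect_bind, expect_pure, expect_const]
    exact Input.matchProb_acceptance hθ.le hθ' hα hαc hnd hL (hmem u) (hmem v) huv
  · intro v
    simp only [I.bind_contention a hnd, expect_bind, expect_pure, hind, expect_const_mul,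
      expect_ind_mem_bernoulliSubset q (Finset.mem_univ v), expect_mul_const]
    rw [mul_comm]
    exact hqf v
  · intro u
    have h1 : ∀ v l', v :: l' <:+ L → ∀ u ∈ l', (a v l' u : ℝ) ≤ 1 - θ := fun v l' h u hu =>
      (Input.acceptance_eq hθ.le hθ' hα hL h hu).2
    have h2 := I.sum_abs_freeCov_le a hθ hθ'.le hnd h1 (hmem u)
    rw [huniv] at h2
    refine (Finset.sum_le_sum fun w hw => ?_).trans h2
    have h3 : expect ((realizationLaw I.H I.p).bind (I.contention a L q))
        (fun o => ind (u ∈ o.A) * ind (w ∈ o.A)) = q u * q w * I.freeProb₂ a L u w := by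
      have h5 : ∀ (N : Finset (Sym2 V)) (B : Finset V),
          free N u * ind (u ∈ B) * (free N w * ind (w ∈ B)) =
            free N u * free N w * (ind (u ∈ B) * ind (w ∈ B)) := fun N B => by ring
      simp only [I.bind_contention a hnd, expect_bind, expect_pure, hind, h5, expect_const_mul, expect_ind_mem_mul_bernoulliSubset q (Finset.mem_univ u)
        (Finset.mem_univ w) (Finset.ne_of_mem_erase hw).symm, expect_mul_const, Input.freeProb₂]
      ring
    rw [h3, ← hqf u, ← hqf w]
    have h4 : (q u : ℝ) * q w * I.freeProb₂ a L u w -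
        q u * I.freeProb a L u * (q w * I.freeProb a L w) =
        (q u : ℝ) * q w * I.freeCov a L u w := by
      rw [Input.freeCov]
      ring
    rw [h4, abs_mul, abs_of_nonneg (mul_nonneg (q u).2.1 (q w).2.1)]
    exact mul_le_of_le_one_left (abs_nonneg _)
      (mul_le_one₀ (q u).2.2 (q w).2.1 (q w).2.2)

end Mechanism

/-! ### Water filling in a fractional matching -/

section WaterFilling

open Classical

variable {ι : Type*} [Fintype ι]

/-- Every fractional matching `x` has vertex levels `K ≤ a` with
`K v + ∑ w, max (K v) (K w) * x v w ≤ 1`, and equality at the vertices below level `a`. -/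
theorem exists_levels {x : ι → ι → ℝ} (hx0 : ∀ u v, 0 ≤ x u v)
    (hxs : ∀ v, x v v = 0) (hX : ∀ v, ∑ w, x v w ≤ 1) {a : ℝ} (ha0 : 0 ≤ a) (ha1 : a ≤ 1) :
    ∃ K : ι → ℝ, ∀ v, 0 ≤ K v ∧ K v ≤ a ∧ K v + ∑ w, max (K v) (K w) * x v w ≤ 1 ∧
      (K v < a → K v + ∑ w, max (K v) (K w) * x v w = 1) := by
  -- Levels are fixed in decreasing order, and `S` holds the finished vertices. A pending neighbour
  -- never exceeds a finished one, so it enters with the level of the latter. The middle invariant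
  -- says that a finished level is `a` or at least the common level at which any pending vertex
  -- would fill up.
  suffices h : ∀ n ≤ Fintype.card ι, ∃ (S : Finset ι) (K : ι → ℝ), S.card = n ∧
      (∀ v ∈ S, 0 ≤ K v ∧ K v ≤ a) ∧
      (∀ u ∈ S, ∀ w ∉ S, K u = a ∨
        1 - ∑ s ∈ S, K s * x w s ≤ K u * (1 + ∑ z ∈ Sᶜ, x w z)) ∧
      (∀ v ∈ S, K v + (∑ w ∈ S, max (K v) (K w) * x v w + ∑ w ∈ Sᶜ, K v * x v w) ≤ 1 ∧
        (K v < a →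
          K v + (∑ w ∈ S, max (K v) (K w) * x v w + ∑ w ∈ Sᶜ, K v * x v w) = 1)) by
    obtain ⟨S, K, hS, h1, -, h2⟩ := h _ le_rfl
    obtain rfl := Finset.card_eq_iff_eq_univ S |>.1 hS
    simp only [Finset.compl_univ, Finset.sum_empty, add_zero, Finset.mem_univ, true_imp_iff] at h1 h2
    exact ⟨K, fun v => ⟨(h1 v).1, (h1 v).2, (h2 v).1, (h2 v).2⟩⟩
  intro n
  induction n with
  | zero => exact fun _ => ⟨∅, fun _ => 0, by simp⟩
  | succ n ih =>
    intro hn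
    obtain ⟨S, K, hS, h1, h2, h3⟩ := ih (by omega)
    have hne : Sᶜ.Nonempty := by
      rw [← Finset.card_pos, Finset.card_compl]
      omega
    set A : ι → ℝ := fun w => 1 - ∑ s ∈ S, K s * x w s with hA
    set D : ι → ℝ := fun w => 1 + ∑ z ∈ Sᶜ, x w z with hD
    have hD0 : ∀ w, 0 < D w := fun w =>
      add_pos_of_pos_of_nonneg one_pos (Finset.sum_nonneg fun z _ => hx0 w z)
    have hA0 : ∀ w, 0 ≤ A w := by
      intro w
      have : ∑ s ∈ S, K s * x w s ≤ ∑ s, x w s :=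
        (Finset.sum_le_sum fun s hs =>
          mul_le_of_le_one_left (hx0 w s) ((h1 s hs).2.trans ha1)).trans
          (Finset.sum_le_sum_of_subset_of_nonneg (Finset.subset_univ _) fun s _ _ => hx0 w s)
      simp only [hA]
      linarith [hX w]
    -- `A w / D w` is the level at which `w` fills up if all pending vertices rise together; the
    -- largest one, capped at `a`, is fixed next.
    obtain ⟨v, hv, hmax⟩ := Finset.exists_max_image Sᶜ (fun w => A w / D w) hne
    have hvS : v ∉ S := Finset.mem_compl.1 hv
    set k := min a (A v / D v) with hk
    have hka : k ≤ a := min_le_left _ _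
    have hk0 : 0 ≤ k := le_min ha0 (div_nonneg (hA0 v) (hD0 v).le)
    have hkF : k * D v ≤ A v := (le_div_iff₀ (hD0 v)).1 (min_le_right _ _)
    have hkF' : k < a → k * D v = A v := fun h => by
      rw [hk, min_eq_right (not_lt.1 fun h' => h.not_ge (le_min le_rfl h'.le)),
        div_mul_cancel₀ _ (hD0 v).ne']
    have hkK : ∀ u ∈ S, k ≤ K u := by
      intro u hu
      rcases h2 u hu v hvS with h | h
      · exact h ▸ hka
      · exact (min_le_right _ _).trans ((div_le_iff₀ (hD0 v)).2 h)
    set K' := Function.update K v k with hK'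
    have hK'v : K' v = k := Function.update_self _ _ _
    have hK'S : ∀ s ∈ S, K' s = K s := fun s hs =>
      Function.update_of_ne (fun h => hvS (by rwa [← h])) _ _
    have hcompl : (insert v S)ᶜ = Sᶜ.erase v := Finset.compl_insert
    have hsplit : ∀ f : ι → ℝ, ∑ w ∈ Sᶜ, f w = f v + ∑ w ∈ (insert v S)ᶜ, f w := fun f => by
      rw [hcompl, Finset.add_sum_erase _ _ hv]
    refine ⟨insert v S, K', by rw [Finset.card_insert_of_notMem hvS, hS], ?_, ?_, ?_⟩
    · intro u hu
      rcases Finset.mem_insert.1 hu with rfl | hu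
      · exact ⟨hK'v ▸ hk0, hK'v ▸ hka⟩
      · exact hK'S u hu ▸ h1 u hu
    · intro u hu w hw
      rw [Finset.sum_insert hvS, hK'v, Finset.sum_congr rfl fun s hs => by rw [hK'S s hs]]
      have hkK' : k ≤ K' u := by
        rcases Finset.mem_insert.1 hu with rfl | hu
        · exact hK'v.ge
        · exact hK'S u hu ▸ hkK u hu
      have hK'a : K' u ≤ a := by
        rcases Finset.mem_insert.1 hu with rfl | hu
        · exact hK'v ▸ hka
        · exact hK'S u hu ▸ (h1 u hu).2
      by_cases hka' : k < a
      · right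
        have hw' : w ∈ Sᶜ := Finset.mem_compl.2 fun h => hw (Finset.mem_insert_of_mem h)
        have h4 : A w ≤ k * D w := by
          rw [← div_le_iff₀ (hD0 w)]
          refine (hmax w hw').trans (le_of_eq ?_)
          rw [div_eq_iff (hD0 v).ne', hkF' hka']
        have h5 : D w = 1 + (x w v + ∑ z ∈ (insert v S)ᶜ, x w z) := by
          simp only [hD]
          rw [hsplit]
        have h6 : 0 ≤ ∑ z ∈ (insert v S)ᶜ, x w z := Finset.sum_nonneg fun z _ => hx0 w z
        simp only [hA] at h4
        rw [h5] at h4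
        nlinarith
      · left
        exact hK'a.antisymm ((not_lt.1 hka').trans hkK')
    · intro u hu
      rw [Finset.sum_insert hvS, hK'v]
      rcases Finset.mem_insert.1 hu with rfl | hu
      · have h4 : ∑ w ∈ S, max (K' u) (K' w) * x u w = ∑ s ∈ S, K s * x u s :=
          Finset.sum_congr rfl fun s hs => by rw [hK'v, hK'S s hs, max_eq_right (hkK s hs)]
        have h5 : K' u + (max (K' u) k * x u u + ∑ w ∈ S, max (K' u) (K' w) * x u w +
            ∑ w ∈ (insert u S)ᶜ, K' u * x u w) = k * D u - A u + 1 := by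
          simp only [hA, hD]
          rw [h4, hsplit, hxs, hK'v, ← Finset.mul_sum]
          ring
        rw [h5, hK'v]
        exact ⟨by linarith, fun h => by rw [hkF' h]; ring⟩
      · have h4 : K' u + (max (K' u) k * x u v + ∑ w ∈ S, max (K' u) (K' w) * x u w +
            ∑ w ∈ (insert v S)ᶜ, K' u * x u w) =
            K u + (∑ w ∈ S, max (K u) (K w) * x u w + ∑ w ∈ Sᶜ, K u * x u w) := by
          rw [hsplit, hK'S u hu, max_eq_left (hkK u hu),
            Finset.sum_congr rfl fun s hs => by rw [hK'S s hs]]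
          ring
        rw [h4, hK'S u hu]
        exact h3 u hu

/-- An enumeration along which `f` increases. -/
theorem exists_sorted_list (f : ι → ℝ) :
    ∃ L : List ι, L.Nodup ∧ (∀ v, v ∈ L) ∧ L.Pairwise fun u v => f u ≤ f v := by
  have : Std.Total fun u v : ι => f u ≤ f v := ⟨fun u v => le_total _ _⟩
  have : IsTrans ι fun u v : ι => f u ≤ f v := ⟨fun _ _ _ => le_trans⟩
  have h := List.perm_insertionSort (fun u v : ι => f u ≤ f v) Finset.univ.toList
  exact ⟨_, h.nodup_iff.2 (Finset.nodup_toList _),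
    fun v => h.mem_iff.2 (Finset.mem_toList.2 (Finset.mem_univ v)),
    List.pairwise_insertionSort _ _⟩

end WaterFilling

/-! ### The arrival order by decreasing level -/

section Levels

open Classical

variable {ι : Type*} [Fintype ι]

/-- `K` assigns to the vertices of the fractional matching `x` levels at most `2 / 3`, as found by
water filling. -/
structure IsLevels (x : ι → ι → ℝ) (K : ι → ℝ) : Prop where
  nonneg : ∀ u v, 0 ≤ x u v
  sum_le : ∀ v, ∑ w, x v w ≤ 1
  level_nonneg : ∀ v, 0 ≤ K v
  level_le : ∀ v, K v ≤ 2 / 3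
  fill_le : ∀ v, K v + ∑ w, max (K v) (K w) * x v w ≤ 1
  fill_eq : ∀ v, K v < 2 / 3 → K v + ∑ w, max (K v) (K w) * x v w = 1

/-- The share of an edge that is left for the second arrival order. -/
noncomputable def residual (x : ι → ι → ℝ) (K : ι → ℝ) (u v : ι) : ℝ :=
  8 / 15 + 1 / 1000 - 14 / 100 * (∑ w, x u w) * (∑ w, x v w) - 69 / 100 * max (K u) (K v)

theorem residual_comm (x : ι → ι → ℝ) (K : ι → ℝ) (u v : ι) :
    residual x K u v = residual x K v u := by
  rw [residual, residual, max_comm]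
  ring

variable {x : ι → ι → ℝ} {K : ι → ℝ}

theorem IsLevels.sum_nonneg (h : IsLevels x K) (v : ι) : 0 ≤ ∑ w, x v w :=
  Finset.sum_nonneg fun w _ => h.nonneg v w

theorem IsLevels.level_mul_le (h : IsLevels x K) (v : ι) : K v * (1 + ∑ w, x v w) ≤ 1 := by
  refine le_trans ?_ (h.fill_le v)
  rw [mul_add, mul_one, Finset.mul_sum]
  gcongr with w
  · exact h.nonneg v w
  · exact le_max_left _ _

/-- Below the cap the constraint is tight, so a low level forces a large degree in `x`. -/
theorem IsLevels.le_mul_sum (h : IsLevels x K) {v : ι} (hv : K v < 2 / 3) :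
    1 - K v ≤ 2 / 3 * ∑ w, x v w := by
  rw [← h.fill_eq v hv, add_sub_cancel_left, Finset.mul_sum]
  exact Finset.sum_le_sum fun w _ =>
    mul_le_mul_of_nonneg_right (max_le (h.level_le v) (h.level_le w)) (h.nonneg v w)

theorem IsLevels.level_add_sum_le (h : IsLevels x K) {u v : ι} (huv : K v ≤ K u) (T : Finset ι) :
    max (K u) (K v) + ∑ w ∈ T, max (K u) (K w) * x u w ≤ 1 := by
  rw [max_eq_left huv]
  refine le_trans ?_ (h.fill_le u)
  gcongr
  · exact fun w _ _ => mul_nonneg ((h.level_nonneg u).trans (le_max_left _ _)) (h.nonneg u w)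
  · exact Finset.subset_univ T

theorem IsLevels.residual_nonneg (h : IsLevels x K) (u v : ι) : 0 ≤ residual x K u v := by
  wlog huv : K v ≤ K u generalizing u v
  · rw [residual_comm]
    exact this v u (le_of_not_ge huv)
  rw [residual, max_eq_left huv]
  have h1 := h.sum_nonneg u
  have h2 := h.sum_le u
  have h3 := h.level_mul_le u
  have h4 := h.level_le u
  have h5 := mul_le_mul_of_nonneg_left (h.sum_le v) h1
  nlinarith [mul_nonneg (sub_nonneg.2 h2) (sub_nonneg.2 h4)]

/-- A bound for `residual` that involves the level of `w` only. -/
noncomputable def residualBound (X m : ℝ) : ℝ :=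
  8 / 15 + 1 / 1000 - 21 / 100 * X * (1 - m) - 69 / 100 * m

theorem residualBound_nonneg {X m : ℝ} (hX : X ≤ 1) (hm : m ≤ 2 / 3) : 0 ≤ residualBound X m := by
  rw [residualBound]
  nlinarith [mul_nonneg (sub_nonneg.2 hX) (sub_nonneg.2 hm)]

/-- By `le_mul_sum` the degree of `w` is at least (3/2)(1 - K w), and 21 = 14 · 3/2. The bound is
affine in the maximum, so summing it against `x` only needs `fill_eq`. -/
theorem IsLevels.residual_le_residualBound (h : IsLevels x K) (u : ι) {w : ι} (hw : K w < 2 / 3) :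
    residual x K u w ≤ residualBound (∑ z, x u z) (max (K u) (K w)) := by
  rw [residual, residualBound]
  have h1 := mul_le_mul_of_nonneg_left (h.le_mul_sum hw) (h.sum_nonneg u)
  have h2 := mul_le_mul_of_nonneg_left (le_max_right (K u) (K w)) (h.sum_nonneg u)
  nlinarith

theorem IsLevels.residual_le (h : IsLevels x K) (u w : ι) :
    residual x K u w ≤ 8 / 15 + 1 / 1000 - 69 / 100 * max (K u) (K w) := by
  rw [residual]
  have := mul_nonneg (h.sum_nonneg u) (h.sum_nonneg w)
  linarith

/-- At the cap the degree of `u` is at most 1/2, and every residual is at most 8/15 + 1/1000 -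
46/100. -/
theorem IsLevels.residual_add_sum_le_of_level_eq (h : IsLevels x K) {u : ι} (hu : K u = 2 / 3)
    (v : ι) (T : Finset ι) :
    residual x K u v + ∑ w ∈ T, residual x K u w * x u w ≤ 17 / 100 := by
  have hmax : ∀ w, max (K u) (K w) = 2 / 3 := fun w =>
    (max_le hu.le (h.level_le w)).antisymm (hu.ge.trans (le_max_left _ _))
  have h1 : ∀ w, residual x K u w ≤ 8 / 15 + 1 / 1000 - 69 / 100 * (2 / 3) := fun w =>
    hmax w ▸ h.residual_le u w
  have h2 : ∑ w ∈ T, residual x K u w * x u w ≤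
      (8 / 15 + 1 / 1000 - 69 / 100 * (2 / 3)) * ∑ w, x u w := by
    rw [Finset.mul_sum]
    refine (Finset.sum_le_sum_of_subset_of_nonneg (Finset.subset_univ T) fun w _ _ =>
      mul_nonneg (h.residual_nonneg u w) (h.nonneg u w)).trans (Finset.sum_le_sum fun w _ =>
      mul_le_mul_of_nonneg_right (h1 w) (h.nonneg u w))
  have h3 := h.level_mul_le u
  rw [hu] at h3
  linarith [h1 v]

/-- After K v is lowered to K u the levels cancel. What remains is (8/15 + 1/1000)(1 + X) - 0.21 X²
- 0.69, which is largest at X = 1, where it is about 0.1687. -/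
theorem IsLevels.residual_add_sum_le_of_lt (h : IsLevels x K) {u v : ι} (huv : K u ≤ K v)
    (hv : K v < 2 / 3) {T : Finset ι} (hT : ∀ w ∈ T, K w ≤ K v) :
    residual x K u v + ∑ w ∈ T, residual x K u w * x u w ≤ 17 / 100 := by
  have hX := h.sum_le u
  have hfill := h.fill_eq u (huv.trans_lt hv)
  have h1 := h.residual_le_residualBound u hv
  have h2 : ∑ w ∈ T, residual x K u w * x u w ≤
      ∑ w, residualBound (∑ z, x u z) (max (K u) (K w)) * x u w := by
    refine (Finset.sum_le_sum fun w hw => mul_le_mul_of_nonneg_right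
      (h.residual_le_residualBound u ((hT w hw).trans_lt hv)) (h.nonneg u w)).trans
      (Finset.sum_le_sum_of_subset_of_nonneg (Finset.subset_univ T) fun w _ _ => mul_nonneg
        (residualBound_nonneg hX
          (max_le (h.level_le u) (h.level_le w))) (h.nonneg u w))
  have h3 : ∀ w, residualBound (∑ z, x u z) (max (K u) (K w)) * x u w =
      (8 / 15 + 1 / 1000 - 21 / 100 * ∑ z, x u z) * x u w +
        (21 / 100 * ∑ z, x u z - 69 / 100) * (max (K u) (K w) * x u w) := fun w => by
    rw [residualBound]
    ring
  simp only [h3, Finset.sum_add_distrib, ← Finset.mul_sum] at h2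
  rw [max_eq_right huv, residualBound] at h1
  set X := ∑ w, x u w
  have h4 : ∑ w, max (K u) (K w) * x u w = 1 - K u := by linarith
  rw [h4] at h2
  nlinarith [mul_nonneg (sub_nonneg.2 huv) (sub_nonneg.2 hX)]

theorem residual_quadratic {X k l : ℝ} (hk : k < 2 / 3) (hX : X ≤ 1) (hX0 : 0 ≤ X)
    (h1 : 1 - k ≤ 2 / 3 * X) (h2 : k * (1 + X) ≤ 1) (h3 : k + (k * (X - l) + 2 / 3 * l) ≤ 1) :
    (8 / 15 + 1 / 1000) * (1 + X) - 21 / 100 * X * (X - 1 + k - l / 3) -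
      69 / 100 * (5 / 3 - k) ≤ 17 / 100 := by
  -- Multiplying by 2/3 - k lets `h3` eliminate `l`. At X = 1 the right side is a quadratic in `k`
  -- whose positive minimum is near 0.449.
  have h4 : 0 ≤ (2 / 3 - k) * (17 / 100 - (8 / 15 + 1 / 1000) * (1 + X) +
      21 / 100 * X * (X - 1 + k) + 69 / 100 * (5 / 3 - k)) - 7 / 100 * X * (1 - k - k * X) := by
    nlinarith [sq_nonneg (k - 0.449), mul_nonneg (sub_nonneg.2 hX) (sub_nonneg.2 hk.le),
      mul_nonneg (sub_nonneg.2 h1) (sub_nonneg.2 hk.le),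
      mul_nonneg (sub_nonneg.2 hX) (sub_nonneg.2 h1),
      mul_nonneg (sub_nonneg.2 h2) (sub_nonneg.2 hk.le),
      mul_nonneg (sub_nonneg.2 h2) (sub_nonneg.2 hX)]
  have h5 : (2 / 3 - k) * l ≤ 1 - k - k * X := by linarith
  have h6 := mul_le_mul_of_nonneg_left h5 hX0
  have h7 : 0 ≤ (2 / 3 - k) * (17 / 100 - ((8 / 15 + 1 / 1000) * (1 + X) -
      21 / 100 * X * (X - 1 + k - l / 3) - 69 / 100 * (5 / 3 - k))) := by
    linarith
  linarith [nonneg_of_mul_nonneg_right h7 (sub_pos.2 hk)]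

/-- Neighbours at the cap need not have large degree, so `residualBound` fails for them. Their total
mass `l` is charged the surplus 0.21 X (1 - 2/3) = 0.07 X, and `fill_eq` limits `l`. -/
theorem IsLevels.residual_add_sum_le_of_lt_of_eq (h : IsLevels x K) {u v : ι} (hu : K u < 2 / 3)
    (hv : K v = 2 / 3) (T : Finset ι) :
    residual x K u v + ∑ w ∈ T, residual x K u w * x u w ≤ 17 / 100 := by
  have hX0 := h.sum_nonneg u
  have hX := h.sum_le u
  have hfill := h.fill_eq u hu
  set l := ∑ w, if K w < 2 / 3 then 0 else x u w with hl
  set X := ∑ w, x u w with hXdef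
  have h1 := h.residual_le u v
  rw [max_eq_right (hu.le.trans hv.ge), hv] at h1
  have h2 : ∀ w, residual x K u w * x u w ≤
      (8 / 15 + 1 / 1000 - 21 / 100 * X) * x u w +
        ((21 / 100 * X - 69 / 100) * (max (K u) (K w) * x u w) +
          7 / 100 * X * if K w < 2 / 3 then 0 else x u w) := by
    intro w
    split_ifs with hw
    · have := mul_le_mul_of_nonneg_right (h.residual_le_residualBound u hw) (h.nonneg u w)
      rw [residualBound] at this
      linarith
    · have hw' : max (K u) (K w) = 2 / 3 := by
        rw [max_eq_right (hu.le.trans (not_lt.1 hw))]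
        exact (h.level_le w).antisymm (not_lt.1 hw)
      have := mul_le_mul_of_nonneg_right (h.residual_le u w) (h.nonneg u w)
      rw [hw'] at this ⊢
      linarith
  have h3 : ∑ w ∈ T, residual x K u w * x u w ≤ ∑ w, residual x K u w * x u w :=
    Finset.sum_le_sum_of_subset_of_nonneg (Finset.subset_univ T) fun w _ _ =>
      mul_nonneg (h.residual_nonneg u w) (h.nonneg u w)
  have h4 := h3.trans (Finset.sum_le_sum fun w _ => h2 w)
  simp only [Finset.sum_add_distrib, ← Finset.mul_sum] at h4
  rw [← hl, ← hXdef] at h4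
  have h5 : ∑ w, max (K u) (K w) * x u w = 1 - K u := by linarith
  rw [h5] at h4
  have h6 : K u * (X - l) + 2 / 3 * l ≤ 1 - K u := by
    rw [← h5, hXdef, hl, ← Finset.sum_sub_distrib, Finset.mul_sum, Finset.mul_sum,
      ← Finset.sum_add_distrib]
    refine Finset.sum_le_sum fun w _ => ?_
    split_ifs with hw
    · rw [sub_zero, mul_zero, add_zero]
      exact mul_le_mul_of_nonneg_right (le_max_left _ _) (h.nonneg u w)
    · rw [sub_self, mul_zero, zero_add]
      exact mul_le_mul_of_nonneg_right ((not_lt.1 hw).trans (le_max_right _ _)) (h.nonneg u w)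
  have h7 := residual_quadratic hu hX hX0 (h.le_mul_sum hu) (h.level_mul_le u)
    (l := l) (by linarith)
  linarith

/-- The residual shares can be matched when the vertices arrive by increasing level. -/
theorem IsLevels.residual_add_sum_le (h : IsLevels x K) {u v : ι} (huv : K u ≤ K v)
    {T : Finset ι} (hT : ∀ w ∈ T, K w ≤ K v) :
    residual x K u v + ∑ w ∈ T, residual x K u w * x u w ≤ 17 / 100 := by
  rcases (h.level_le v).lt_or_eq with hv | hv
  · exact h.residual_add_sum_le_of_lt huv hv hT
  · rcases (h.level_le u).lt_or_eq with hu | hu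
    · exact h.residual_add_sum_le_of_lt_of_eq hu hv T
    · exact h.residual_add_sum_le_of_level_eq hu v T

theorem IsLevels.residual_le_const (h : IsLevels x K) (u v : ι) :
    residual x K u v ≤ 17 / 100 := by
  wlog huv : K u ≤ K v generalizing u v
  · rw [residual_comm]
    exact this v u (le_of_not_ge huv)
  simpa using h.residual_add_sum_le huv (T := ∅) (by simp)

end Levels

/-! ### The algorithm -/

section Assembly

open Classical

theorem exists_pmf_three {c₀ c₁ c₂ : ℝ} (h₀ : 0 ≤ c₀) (h₁ : 0 ≤ c₁) (h₂ : 0 ≤ c₂)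
    (h : c₀ + c₁ + c₂ = 1) :
    ∃ μ : PMF (Fin 3), ∀ f : Fin 3 → ℝ, expect μ f = c₀ * f 0 + c₁ * f 1 + c₂ * f 2 := by
  refine ⟨PMF.ofFintype ![ENNReal.ofReal c₀, ENNReal.ofReal c₁, ENNReal.ofReal c₂] ?_, fun f => ?_⟩
  · simp only [Fin.sum_univ_three, Matrix.cons_val]
    rw [← ENNReal.ofReal_add h₀ h₁, ← ENNReal.ofReal_add (add_nonneg h₀ h₁) h₂, h,
      ENNReal.ofReal_one]
  · simp [expect_eq_sum, Fin.sum_univ_three, ENNReal.toReal_ofReal, h₀, h₁, h₂]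

variable {V : Type u} [Fintype V]

theorem Input.feasible_smul (I : Input V) {θ : ℝ} (hθ : 0 ≤ θ) (hθ' : θ ≤ 1) {β : V → V → ℝ}
    (hβ : ∀ u v, 0 ≤ β u v) {L : List V}
    (h : ∀ v l, v :: l <:+ L → ∀ u ∈ l, β u v + ∑ w ∈ l.toFinset, β u w * I.edgeProb u w ≤ 1) :
    I.Feasible θ (fun u v => (1 - θ) * β u v) L := by
  intro v l hl u hu
  refine mul_le_mul_of_nonneg_left ?_ (by linarith)
  have h1 := h v l hl u hu
  have h2 : 0 ≤ ∑ w ∈ l.toFinset, β u w * I.edgeProb u w :=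
    Finset.sum_nonneg fun w _ => mul_nonneg (hβ u w) (I.edgeProb_nonneg u w)
  simp only [mul_assoc, ← Finset.mul_sum]
  nlinarith

theorem Input.exists_isLevels (I : Input V) : ∃ K : V → ℝ, IsLevels I.edgeProb K := by
  obtain ⟨K, hK⟩ := exists_levels I.edgeProb_nonneg I.edgeProb_self I.sum_edgeProb_le_one
    (by norm_num : (0 : ℝ) ≤ 2 / 3) (by norm_num)
  exact ⟨K, I.edgeProb_nonneg, I.sum_edgeProb_le_one, fun v => (hK v).1, fun v => (hK v).2.1,
    fun v => (hK v).2.2.1, fun v => (hK v).2.2.2⟩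

theorem pairwise_suffix {α : Type*} {r : α → α → Prop} {L l : List α} {v : α} (h : L.Pairwise r)
    (hl : v :: l <:+ L) {u : α} (hu : u ∈ l) : r v u :=
  (List.pairwise_cons.1 (h.sublist hl.sublist)).1 u hu

/-- The head of the list, last to arrive, has the least level. So `u` has the larger level in each
new pair, and feasibility reduces to `fill_le`. -/
theorem Input.exists_isMechanism_level (I : Input V) {K : V → ℝ} (hK : IsLevels I.edgeProb K)
    {θ : ℝ} (hθ : 0 < θ) (hθ' : θ < 1) :
    ∃ κ, I.IsMechanism κ (fun u v => (1 - θ) * max (K u) (K v) * I.edgeProb u v)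
      (fun v => 1 - (1 - θ) * ∑ u, I.edgeProb v u) (3 * (1 + 1 / θ) / θ) := by
  obtain ⟨L, hnd, hmem, hs⟩ := exists_sorted_list K
  have h0 : ∀ u v, 0 ≤ max (K u) (K v) := fun u v => (hK.level_nonneg u).trans (le_max_left _ _)
  refine I.exists_isMechanism_of_feasible hθ hθ' (α := fun u v => (1 - θ) * max (K u) (K v))
    (fun u v => mul_nonneg (by linarith) (h0 u v)) (fun u v => by rw [max_comm])
    (fun u v _ => mul_le_of_le_one_right (by linarith) ?_) hnd hmem
    (I.feasible_smul hθ.le hθ'.le h0 fun v l hl u hu =>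
      hK.level_add_sum_le (pairwise_suffix hs hl hu) _)
  exact max_le ((hK.level_le u).trans (by norm_num)) ((hK.level_le v).trans (by norm_num))

theorem Input.exists_isMechanism_residual (I : Input V) {K : V → ℝ} (hK : IsLevels I.edgeProb K)
    {θ : ℝ} (hθ : 0 < θ) (hθ' : θ < 1) :
    ∃ κ, I.IsMechanism κ
      (fun u v => (1 - θ) * (residual I.edgeProb K u v / (17 / 100)) * I.edgeProb u v)
      (fun v => 1 - (1 - θ) * ∑ u, I.edgeProb v u) (3 * (1 + 1 / θ) / θ) := by
  -- The sign reverses the order: vertices now arrive by increasing level.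
  obtain ⟨L, hnd, hmem, hs⟩ := exists_sorted_list fun v => -K v
  have h0 : ∀ u v, 0 ≤ residual I.edgeProb K u v / (17 / 100) := fun u v =>
    div_nonneg (hK.residual_nonneg u v) (by norm_num)
  refine I.exists_isMechanism_of_feasible hθ hθ'
    (α := fun u v => (1 - θ) * (residual I.edgeProb K u v / (17 / 100)))
    (fun u v => mul_nonneg (by linarith) (h0 u v)) (fun u v => by rw [residual_comm])
    (fun u v _ => mul_le_of_le_one_right (by linarith)
      (div_le_one_of_le₀ (hK.residual_le_const u v) (by norm_num))) hnd hmem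
    (I.feasible_smul hθ.le hθ'.le h0 fun v l hl u hu => ?_)
  have h1 := hK.residual_add_sum_le (neg_le_neg_iff.1 (pairwise_suffix hs hl hu))
    (T := l.toFinset) fun w hw =>
      neg_le_neg_iff.1 (pairwise_suffix hs hl (List.mem_toFinset.1 hw))
  simp only [div_mul_eq_mul_div, ← Finset.sum_div, ← add_div]
  exact div_le_one_of_le₀ h1 (by norm_num)

theorem Input.exists_mixture (I : Input V) :
    ∃ κ : Finset (Sym2 V) → PMF (Output V),
      (∀ R, R ⊆ edges I.H → ∀ o ∈ (κ R).support,
        IsMatchingOf R o.Mc ∧ ∀ v ∈ o.A, ¬ Covers o.Mc v) ∧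
      (∀ u v, u ≠ v → 8 / 15 * I.edgeProb u v ≤
        expect ((realizationLaw I.H I.p).bind κ) (fun o => ind (s(u, v) ∈ o.Mc))) ∧
      (∀ v, 1 - ∑ u, I.edgeProb v u ≤
        expect ((realizationLaw I.H I.p).bind κ) (fun o => ind (v ∈ o.A))) ∧
      (∀ u v, u ≠ v → 14 / 100 * (1 / 2000) ^ 2 ≤
        expect ((realizationLaw I.H I.p).bind κ) (fun o => ind (u ∈ o.A) * ind (v ∈ o.A))) ∧
      ∀ (S : Finset V) (c : V → ℝ) (m : ℝ), (∀ i ∈ S, 0 ≤ c i) → (∀ i ∈ S, c i ≤ m) →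
        var ((realizationLaw I.H I.p).bind κ) (fun o => ∑ i ∈ S, c i * ind (i ∈ o.A)) ≤
          m * (∑ i ∈ S, c i) * (1 + 3 * (1 + 2000) * 2000) := by
  obtain ⟨K, hK⟩ := I.exists_isLevels
  have hX0 := hK.sum_nonneg
  have hX := hK.sum_le
  obtain ⟨κ₀, h₀⟩ := I.exists_isMechanism_level hK (θ := 1 / 2000) (by norm_num) (by norm_num)
  obtain ⟨κ₁, h₁⟩ := I.exists_isMechanism_residual hK (θ := 1 / 2000) (by norm_num) (by norm_num)
  set p : V → unitInterval := fun v => ⟨1 - (1 - 1 / 2000) * ∑ u, I.edgeProb v u, by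
    have := hX v; linarith, by have := hX0 v; linarith⟩ with hp
  have h₂ := I.isMechanism_thin p
  have hp0 : ∀ v, (1 / 2000 : ℝ) ≤ p v := fun v => by
    simp only [hp]
    linarith [hX v]
  obtain ⟨μ, hμ⟩ := exists_pmf_three (c₀ := 69 / 100) (c₁ := 17 / 100) (c₂ := 14 / 100)
    (by norm_num) (by norm_num) (by norm_num) (by norm_num)
  set κ : Fin 3 → Finset (Sym2 V) → PMF (Output V) := ![κ₀, κ₁, I.thin p] with hκ
  have hlaw : ∀ f : Output V → ℝ,
      expect ((realizationLaw I.H I.p).bind fun R => μ.bind fun i => κ i R) f =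
        69 / 100 * expect ((realizationLaw I.H I.p).bind κ₀) f +
        17 / 100 * expect ((realizationLaw I.H I.p).bind κ₁) f +
        14 / 100 * expect ((realizationLaw I.H I.p).bind (I.thin p)) f := by
    intro f
    rw [PMF.bind_comm, expect_bind, hμ]
    rfl
  have hpair : ∀ u v, 0 ≤ expect ((realizationLaw I.H I.p).bind κ₀)
      (fun o => ind (u ∈ o.A) * ind (v ∈ o.A)) ∧ 0 ≤ expect ((realizationLaw I.H I.p).bind κ₁)
      (fun o => ind (u ∈ o.A) * ind (v ∈ o.A)) := fun u v =>
    ⟨expect_nonneg fun _ _ => mul_nonneg (ind_nonneg _) (ind_nonneg _),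
      expect_nonneg fun _ _ => mul_nonneg (ind_nonneg _) (ind_nonneg _)⟩
  refine ⟨fun R => μ.bind fun i => κ i R, ?_, ?_, ?_, ?_, ?_⟩
  · intro R hR o ho
    obtain ⟨i, -, ho⟩ := (PMF.mem_support_bind_iff _ _ _).1 ho
    fin_cases i
    exacts [h₀.valid R hR o ho, h₁.valid R hR o ho, h₂.valid R hR o ho]
  -- The three shares add up to (1 - θ)(8/15 + 1/1000) - 0.14 θ(1 - θ) X_u X_v; the slack 1/1000 in
  -- `residual` covers the losses due to θ = 1/2000.
  · intro u v huv
    rw [hlaw, h₀.edge u v huv, h₁.edge u v huv, h₂.edge u v huv, residual]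
    simp only [hp]
    have h1 : (∑ w, I.edgeProb u w) * ∑ w, I.edgeProb v w ≤ 1 :=
      mul_le_one₀ (hX u) (hX0 v) (hX v)
    have h2 := mul_le_mul_of_nonneg_left h1 (I.edgeProb_nonneg u v)
    have h3 := I.edgeProb_nonneg u v
    nlinarith
  · intro v
    rw [hlaw, h₀.mem, h₁.mem, h₂.mem]
    simp only [hp]
    linarith [hX0 v]
  -- The independent set of the third mechanism suffices, as each of its marginals is at least θ.
  · intro u v huv
    rw [hlaw, I.expect_thin_mem_mul_mem p huv]
    have h1 := mul_le_mul (hp0 u) (hp0 v) (by norm_num) (p u).2.1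
    have h2 := hpair u v
    linarith
  -- The components have the same mean, so the second moment of the mixture about it is the average
  -- of theirs.
  · intro S c m hc hm
    refine (var_le_expect_sub_sq _ _ (∑ i ∈ S, c i * p i)).trans ?_
    rw [hlaw]
    have e₀ := expect_sq_sum_le _ (fun v (o : Output V) => v ∈ o.A) h₀.mem h₀.cov S hc hm
    have e₁ := expect_sq_sum_le _ (fun v (o : Output V) => v ∈ o.A) h₁.mem h₁.cov S hc hm
    have e₂ := expect_sq_sum_le _ (fun v (o : Output V) => v ∈ o.A) h₂.mem h₂.cov S hc hm
    have h1 : 0 ≤ m * ∑ i ∈ S, c i := by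
      rcases S.eq_empty_or_nonempty with rfl | ⟨i, hi⟩
      · simp
      · exact mul_nonneg ((hc i hi).trans (hm i hi)) (Finset.sum_nonneg hc)
    norm_num at e₀ e₁ e₂ ⊢
    simp only [hp] at e₂ ⊢
    norm_num at e₂ ⊢
    linarith

theorem expect_sum_mem {α ι : Type*} [Finite α] (μ : PMF α) (M : α → Finset ι)
    {E : Finset ι} (hM : ∀ a ∈ μ.support, M a ⊆ E) (w : ι → ℝ) :
    expect μ (fun a => ∑ e ∈ M a, w e) = ∑ e ∈ E, w e * expect μ fun a => ind (e ∈ M a) := by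
  simp only [← expect_const_mul, ← expect_sum]
  refine expect_congr fun a ha => ?_
  simp only [ind_eq_ite, mul_ite, mul_one, mul_zero]
  rw [← Finset.sum_filter, Finset.filter_mem_eq_inter, Finset.inter_eq_right.2 (hM a ha)]

/-- An `8 / 15`-approximation variance-bounding matching algorithm exists. -/
theorem exists_isVarianceBounding :
    ∃ B : RandomizedAlgorithm.{u}, B.IsVarianceBounding (8 / 15) := by
  choose κ hvalid hedge hmem hpair hvar using
    fun (V : Type u) (_ : Fintype V) (I : Input V) => I.exists_mixture
  set C : ℝ := 1 + 3 * (1 + 2000) * 2000 with hC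
  set d : ℝ := 14 / 100 * (1 / 2000) ^ 2 with hd
  have hC1 : 1 ≤ C := by norm_num [hC]
  have hd0 : 0 < d := by norm_num [hd]
  have hdC : d / C ≤ d := div_le_self hd0.le hC1
  -- `d` bounds the pair probabilities, and the variance is at most τC/d². Taking δ = d/C instead of
  -- `d` absorbs the factor `C`, since C ≤ 6C².
  refine ⟨⟨fun V _ I => κ V _ I⟩, d / C, by positivity, hdC.trans_lt (by norm_num [hd]),
    fun V _ I => ⟨hvalid V _ I, ?_, ?_, ?_, ?_⟩⟩
  · intro w hw
    have hsupp : ∀ o ∈ ((realizationLaw I.H I.p).bind (κ V _ I)).support, o.Mc ⊆ edges I.H := by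
      intro o ho
      obtain ⟨R, hR, ho⟩ := (PMF.mem_support_bind_iff _ _ _).1 ho
      rw [realizationLaw_eq] at hR
      have hR := subset_of_mem_support hR
      exact (hvalid V _ I R hR o ho).1.1.trans hR
    rw [RandomizedAlgorithm.outLaw, expect_sum_mem _ _ hsupp,
      expect_sum_mem I.lawMO (fun M => M) (E := edges I.H)
        fun M hM => (I.isMatchingOf_of_mem_support hM).1, Finset.mul_sum]
    refine Finset.sum_le_sum fun e he => ?_
    rw [mul_left_comm]
    refine mul_le_mul_of_nonneg_left ?_ (hw e he)
    induction e with
    | h u v =>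
      have := hedge V _ I u v (mem_edges.1 he).ne
      rwa [Input.edgeProb, prob_eq_expect] at this
  · intro v
    rw [I.prob_not_covers, prob_eq_expect]
    exact hmem V _ I v
  · intro u v huv _
    rw [prob_eq_expect]
    simp only [ind_and]
    exact hdC.trans (hpair V _ I u v huv)
  · intro τ hτ _ x hx hxτ v
    set ν := (realizationLaw I.H I.p).bind (κ V _ I) with hν
    have hadj : ∀ u ∈ nbrs I.Hᶜ v, I.Hᶜ.Adj u v := fun u hu => by
      simpa [nbrs, SimpleGraph.adj_comm] using hu
    have hprob : ∀ u ∈ nbrs I.Hᶜ v, d ≤ prob ν fun o => u ∈ o.A ∧ v ∈ o.A := fun u hu => by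
      rw [prob_eq_expect]
      simp only [ind_and]
      exact hpair V _ I u v (hadj u hu).ne
    have hx0 : ∀ u ∈ nbrs I.Hᶜ v, 0 ≤ x s(u, v) := fun u hu =>
      (hx.1 _ ((SimpleGraph.mem_edgeSet _).2 (hadj u hu))).1
    set c : V → ℝ := fun u => x s(u, v) / prob ν fun o => u ∈ o.A ∧ v ∈ o.A with hc
    have hcx : ∀ u ∈ nbrs I.Hᶜ v, c u ≤ x s(u, v) / d := fun u hu =>
      div_le_div_of_nonneg_left (hx0 u hu) hd0 (hprob u hu)
    have hc0 : ∀ u ∈ nbrs I.Hᶜ v, 0 ≤ c u := fun u hu =>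
      div_nonneg (hx0 u hu) (prob_nonneg _ _)
    have hcτ : ∀ u ∈ nbrs I.Hᶜ v, c u ≤ τ / d := fun u hu => (hcx u hu).trans
      (div_le_div_of_nonneg_right (hxτ _ ((SimpleGraph.mem_edgeSet _).2 (hadj u hu))) hd0.le)
    have hcsum : ∑ u ∈ nbrs I.Hᶜ v, c u ≤ 1 / d := by
      refine (Finset.sum_le_sum hcx).trans ?_
      rw [← Finset.sum_div]
      exact div_le_div_of_nonneg_right (hx.2 v) hd0.le
    have hZ : Z I.H ν x v = fun o => ∑ u ∈ nbrs I.Hᶜ v, c u * ind (u ∈ o.A) := by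
      funext o
      simp only [Z, hc, ind_eq_ite]
    change var ν (Z I.H ν x v) ≤ _
    rw [hZ]
    refine (hvar V _ I _ c _ hc0 hcτ).trans ?_
    calc τ / d * (∑ u ∈ nbrs I.Hᶜ v, c u) * C ≤ τ / d * (1 / d) * C := by gcongr
      _ = τ / d ^ 2 * (1 * C) := by field_simp
      _ ≤ τ / d ^ 2 * (6 * C * C) := by
          gcongr
          linarith
      _ = 6 * τ / (d / C) ^ 2 := by field_simp

end Assembly

end StochMatch

theorem lemma6p1 :
    ∃ B : StochMatch.RandomizedAlgorithm.{u}, B.IsVarianceBounding (8 / 15) := by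
  exact StochMatch.exists_isVarianceBounding
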